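/- Let $G=(V,E,w)$ be a weighted complete graph on $n\ge 2$ vertices (symmetric positive weights $w(u,v)$, $u\ne v$). For vertices $u,v$ let $h_G(u,v)\in[0,\infty]$ be the hitting time, i.e. the expected number of steps that the random walk on $G$ (which moves from $x$ to $y$ with probability $w(x,y)/\sum_z w(x,z)$) started at $u$ takes to reach $v$. For $s\in\mathbb N$ let $G'=(V,E',w')$ be the following random sparsification of $G$. Let $C=\sqrt W B$, where $W$ is the diagonal matrix of edge weights and $B$ is the signed edge-vertex incidence matrix. Sample $s$ rows of $C$ independently with replacement, the row of the edge $e$ being chosen with probability $p_e=\|C_{e,*}\|_2^2/\|C\|_F^2$; divide each sampled row by $\sqrt{p_e s}$ (equivalently, multiply the weight of the sampled edge by $1/(p_e s)$), and let $\widetilde C\in\mathbb R^{s\times n}$ be the matrix of these rows. $G'$ is the weighted graph whose Laplacian is $\widetilde C^\top\widetilde C$. Let $0<a\le b$ be constants. Then there is a constant $C_0>0$ depending only on $a,b$ such that the following holds for every $n\ge2$ and every weighted complete graph $G$ on $n$ vertices that is in one of the two settings: 1. (Single cluster) $a\le w(u,v)\le b$ for all $u\ne v$. 2. (Many small clusters)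 $n$ is a perfect square and $V$ is partitioned into $\sqrt n$ clusters of size $\sqrt n$, such that $a\le w(u,v)\le b$ for distinct $u,v$ in the same cluster, and $a/n\le w(u,v)\le b/n$ for $u,v$ in different clusters. All hitting times $h_G(u,v)$ are finite, and for every number of samples $s\ge C_0\cdot n\cdot\max_{u,v\in V}h_G(u,v)$ (in particular for $s=\lceil C_0\, n\max_{u,v}h_G(u,v)\rceil=O(n\cdot\max_{u,v}h_G(u,v))$), with probability at least $0.99$ the graph $G'$ has at most $s$ edges, is connected, has finite hitting times, and satisfies $$|h_G(u,v)-h_{G'}(u,v)|\le\sqrt{n\cdot h_G(u,v)}\qquad\text{for all }u,v\in V.$$ -/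

import Mathlib

open scoped ENNReal

noncomputable section

/-- A weighted undirected graph on `V`: a symmetric non-negative weight function vanishing on the
diagonal. The edges are the pairs of positive weight. -/
structure WGraph (V : Type*) where
  weight : V → V → ℝ
  symm : ∀ u v, weight u v = weight v u
  nonneg : ∀ u v, 0 ≤ weight u v
  loopless : ∀ u, weight u u = 0

namespace WGraph

section Basic

variable {V : Type*} (G : WGraph V)

/-- The underlying simple graph `(V, E)`. -/
def toSimpleGraph : SimpleGraph V where
  Adj u v := 0 < G.weight u v
  symm := ⟨fun u v h => by rw [G.symm]; exact h⟩
  loopless := ⟨fun u h => by rw [G.loopless] at h; exact lt_irrefl _ h⟩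

/-- `G` is a weighted complete graph: every pair of distinct vertices is an edge. -/
def IsComplete : Prop := G.toSimpleGraph = ⊤

/-- `deg(u) = ∑ w(u, z)`. -/
def deg [Fintype V] (u : V) : ℝ := ∑ z, G.weight u z

open Classical in
/-- The graph Laplacian `D - A`. -/
def laplacian [Fintype V] : Matrix V V ℝ :=
  Matrix.diagonal G.deg - Matrix.of G.weight

end Basic

section RandomWalk

variable {V : Type*} [Fintype V] (G : WGraph V)

lemma deg_nonneg (u : V) : 0 ≤ G.deg u := Finset.sum_nonneg fun z _ => G.nonneg u z

lemma sum_step (u : V) (h : G.deg u ≠ 0) :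
    ∑ v, ENNReal.ofReal (G.weight u v / G.deg u) = 1 := by
  rw [← ENNReal.ofReal_sum_of_nonneg fun v _ => div_nonneg (G.nonneg u v) (G.deg_nonneg u),
    ← Finset.sum_div]
  change ENNReal.ofReal (G.deg u / G.deg u) = 1
  rw [div_self h, ENNReal.ofReal_one]

open Classical in
/-- One step of the random walk: from `u` the walk moves to `v` with probability
`w(u, v) / deg(u)`. (A walk at an isolated vertex stays there.) -/
def step (u : V) : PMF V :=
  if h : G.deg u = 0 then PMF.pure u
  else PMF.ofFintype (fun v => ENNReal.ofReal (G.weight u v / G.deg u)) (G.sum_step u h)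

variable [MeasurableSpace V] [DiscreteMeasurableSpace V]

/-- The transition kernel of the random walk. -/
def stepKernel : ProbabilityTheory.Kernel V V where
  toFun u := (G.step u).toMeasure
  measurable' := Measurable.of_discrete

instance : ProbabilityTheory.IsMarkovKernel G.stepKernel :=
  ⟨fun u => PMF.toMeasure.isProbabilityMeasure (G.step u)⟩

/-- The transition at time `t`, given the trajectory up to time `t`: one step from the current
position. -/
def pathKernel (t : ℕ) : ProbabilityTheory.Kernel (Finset.Iic t → V) V :=
  G.stepKernel.comap (fun x => x ⟨t, Finset.mem_Iic.2 le_rfl⟩) (measurable_pi_apply _)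

instance (t : ℕ) : ProbabilityTheory.IsMarkovKernel (G.pathKernel t) := by
  unfold pathKernel; infer_instance

/-- The law, on the space of trajectories, of the random walk on `G` started at `u`. -/
def walkLaw (u : V) : MeasureTheory.Measure (ℕ → V) :=
  ProbabilityTheory.Kernel.traj (X := fun _ => V) G.pathKernel 0 (fun _ => u)

/-- The number of steps a trajectory takes to reach `v` (`⊤` if it never does). -/
def reachTime (v : V) (ω : ℕ → V) : ℝ≥0∞ := ⨅ (t : ℕ) (_ : ω t = v), (t : ℝ≥0∞)

/-- The hitting time `h_G(u, v)`: the expected number of steps for a random walk on `G` started at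
`u` to reach `v`. -/
def hit (u v : V) : ℝ≥0∞ := ∫⁻ ω, reachTime v ω ∂(G.walkLaw u)

end RandomWalk

section Sparsify

variable {V : Type*} [Fintype V] (G : WGraph V)

/-- The edges of `G`. -/
def Edge : Type _ := {e : Sym2 V // e ∈ G.toSimpleGraph.edgeSet}

instance : Fintype G.Edge := by
  classical exact inferInstanceAs (Fintype {e : Sym2 V // e ∈ G.toSimpleGraph.edgeSet})

instance : MeasurableSpace G.Edge := ⊤

instance : DiscreteMeasurableSpace G.Edge := ⟨fun _ => trivial⟩

variable {G}

/-- The positive endpoint of an edge, in an arbitrary orientation. -/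
def Edge.pos (e : G.Edge) : V := (Quot.out e.1).1

/-- The negative endpoint of an edge. -/
def Edge.neg (e : G.Edge) : V := (Quot.out e.1).2

/-- The weight of an edge. -/
def Edge.wt (e : G.Edge) : ℝ := G.weight e.pos e.neg

variable (G)

open Classical in
/-- The signed edge-vertex incidence matrix `B`. -/
def incidence : Matrix G.Edge V ℝ := fun e x =>
  if x = e.pos then 1 else if x = e.neg then -1 else 0

/-- The matrix `C = √W B`. -/
def sqrtWB : Matrix G.Edge V ℝ := fun e x => √e.wt * G.incidence e x

/-- The sampling probability `p_e = ‖C_e‖₂² / ‖C‖_F²` of the row of the edge `e`. -/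
def rowProb (e : G.Edge) : ℝ :=
  (∑ x, G.sqrtWB e x ^ 2) / ∑ e', ∑ x, G.sqrtWB e' x ^ 2

/-- The law of one sampled edge: `e` has probability `p_e`. -/
def edgeLaw : MeasureTheory.Measure G.Edge :=
  ∑ e, ENNReal.ofReal (G.rowProb e) • MeasureTheory.Measure.dirac e

/-- The law of `s` independent samples. -/
def sampleLaw (s : ℕ) : MeasureTheory.Measure (Fin s → G.Edge) :=
  MeasureTheory.Measure.pi fun _ => G.edgeLaw

variable {G}

/-- The `s × n` matrix `C̃` of the sampled rows of `C`, row `j` being divided by `√(p s)`, where `p`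
is the probability of the sampled row (so that `C̃ᵀ C̃` has expectation `Cᵀ C`). -/
def sampledRows {s : ℕ} (σ : Fin s → G.Edge) : Matrix (Fin s) V ℝ := fun j x =>
  G.sqrtWB (σ j) x / √(G.rowProb (σ j) * s)

/-- The matrix `C̃ᵀ C̃`. -/
def sampledGram {s : ℕ} (σ : Fin s → G.Edge) : Matrix V V ℝ :=
  (sampledRows σ).transpose * sampledRows σ

lemma sampledGram_symm {s : ℕ} (σ : Fin s → G.Edge) (u v : V) :
    sampledGram σ u v = sampledGram σ v u := by
  simp only [sampledGram, Matrix.mul_apply, Matrix.transpose_apply]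
  exact Finset.sum_congr rfl fun j _ => mul_comm _ _

lemma sampledGram_nonpos {s : ℕ} (σ : Fin s → G.Edge) {u v : V} (h : u ≠ v) :
    sampledGram σ u v ≤ 0 := by
  simp only [sampledGram, Matrix.mul_apply, Matrix.transpose_apply]
  refine Finset.sum_nonpos fun j _ => ?_
  have hB : G.incidence (σ j) u * G.incidence (σ j) v ≤ 0 := by
    unfold incidence
    split_ifs <;> simp_all
  have hr : sampledRows σ j u * sampledRows σ j v =
      (√(σ j).wt / √(G.rowProb (σ j) * s)) ^ 2 *
        (G.incidence (σ j) u * G.incidence (σ j) v) := by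
    simp only [sampledRows, sqrtWB]; ring
  rw [hr]
  exact mul_nonpos_of_nonneg_of_nonpos (sq_nonneg _) hB

open Classical in
/-- The sparsified graph `G' = (V, E', w')`: the weighted graph whose Laplacian is `C̃ᵀ C̃`
(see `laplacian_sparsify`). -/
def sparsify {s : ℕ} (σ : Fin s → G.Edge) : WGraph V where
  weight u v := if u = v then 0 else -sampledGram σ u v
  symm u v := by
    by_cases h : u = v
    · simp [h]
    · rw [if_neg h, if_neg (Ne.symm h), sampledGram_symm]
  nonneg u v := by
    split_ifs with h
    · exact le_rfl
    · exact neg_nonneg.2 (sampledGram_nonpos σ h)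
  loopless u := if_pos rfl

lemma Edge.pos_ne_neg (e : G.Edge) : e.pos ≠ e.neg := by
  intro h
  have h1 : (Quot.out e.1 : V × V) = (e.pos, e.neg) := rfl
  have h2 : e.1 = s(e.pos, e.neg) := by
    rw [← Quot.out_eq e.1, h1]
  have h3 := e.2
  rw [h2, SimpleGraph.mem_edgeSet] at h3
  exact h3.ne h

lemma laplacian_sparsify {s : ℕ} (σ : Fin s → G.Edge) :
    (sparsify σ).laplacian = sampledGram σ := by
  classical
  have hrow : ∀ u, ∑ v, sampledGram σ u v = 0 := by
    intro u
    simp only [sampledGram, Matrix.mul_apply, Matrix.transpose_apply]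
    rw [Finset.sum_comm]
    refine Finset.sum_eq_zero fun j _ => ?_
    rw [← Finset.mul_sum]
    have h0 : ∑ x, G.incidence (σ j) x = 0 := by
      have hx : ∀ x, G.incidence (σ j) x =
          (if x = (σ j).pos then (1 : ℝ) else 0) + (if x = (σ j).neg then (-1 : ℝ) else 0) := by
        intro x
        unfold incidence
        have := (σ j).pos_ne_neg
        split_ifs <;> simp_all
      simp [hx, Finset.sum_add_distrib]
    have h1 : ∑ x, sampledRows σ j x = 0 := by
      simp only [sampledRows, sqrtWB]
      rw [← Finset.sum_div, ← Finset.mul_sum, h0, mul_zero, zero_div]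
    rw [h1, mul_zero]
  ext u v
  simp only [laplacian, Matrix.sub_apply, Matrix.of_apply]
  by_cases h : u = v
  · subst h
    rw [Matrix.diagonal_apply_eq, (sparsify σ).loopless, sub_zero]
    have hd : (sparsify σ).deg u =
        ∑ z, ((if u = z then sampledGram σ u z else 0) - sampledGram σ u z) := by
      refine Finset.sum_congr rfl fun z _ => ?_
      simp only [sparsify]
      split_ifs <;> simp
    rw [hd, Finset.sum_sub_distrib, hrow, sub_zero]
    simp
  · rw [Matrix.diagonal_apply_ne _ h]
    simp [sparsify, h]

end Sparsify

section Settings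

variable {n : ℕ} (G : WGraph (Fin n))

/-- Single cluster: all edge weights are of constant order, i.e. they lie in `[a, b]`. -/
def IsSingleCluster (a b : ℝ) : Prop :=
  ∀ u v, u ≠ v → a ≤ G.weight u v ∧ G.weight u v ≤ b

/-- Many small clusters: the `n = k²` vertices are partitioned into `k = √n` clusters of size `k`;
the weights inside a cluster are of constant order and those between clusters of order `1/n`. -/
def IsManyClusters (a b : ℝ) : Prop :=
  ∃ k : ℕ, n = k ^ 2 ∧ ∃ c : Fin n → Fin k,
    (∀ i, (Finset.univ.filter fun u => c u = i).card = k) ∧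
    (∀ u v, u ≠ v → c u = c v → a ≤ G.weight u v ∧ G.weight u v ≤ b) ∧
    (∀ u v, c u ≠ c v → a / n ≤ G.weight u v ∧ G.weight u v ≤ b / n)

end Settings

end WGraph

end

/-! In both settings all hitting times between distinct vertices have the same order: they lie
between `c * n` and `K * n`, with `c`, `K` depending only on `a`, `b` (`exists_hitR_bounds`). So the
allowed error √(n h) is at least √c · n, while the maximal hitting time `H` is at most `K * n`. A
uniform error 8εH with a small constant ε therefore suffices.

Such an error follows from a constant-accuracy approximation of the Dirichlet form E(f, g) = ∑ f ·
Lg, namely |E'(f, g) - E(f, g)| ≤ ε √E(f, f) √E(g, g). The hitting time to `v` solves L h = deg off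
`v`, and L h (v) = deg(v) - vol. Hence the difference of the hitting times to `v` and to `u`
represents the functional f ↦ vol · (f u - f v) in E, and Cauchy–Schwarz gives the resistance bound
(f u - f v)² ≤ ρ E(f, f) with ρ = 2H / vol (`gap_of_hit_le`). Testing the equations for h and h'
against f = h - h' bounds E(f, f), and ρ converts this into a pointwise bound (`abs_hitR_sub_le`).

The approximation holds with probability 0.99 by a second-moment argument (`sampleLaw_form_close`).
In an orthonormal basis the expected squared Hilbert–Schmidt norm of E' - E is at most (W / s) ρ n,
where W is the total edge weight. As vol = 2W, this equals nH / s, and Markov's inequality asks for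
s ≥ 100 nH / ε². On the good event G' inherits a resistance bound, which yields connectivity and
finite hitting times. -/

noncomputable section

namespace WGraph

/-! ### Reaching times as sums of survival indicators -/

section Alive

variable {V : Type*}

open Classical in
/-- The function `g` set to zero at `v`. -/
def kill (v : V) (g : V → ℝ≥0∞) (u : V) : ℝ≥0∞ := if u = v then 0 else g u

@[simp] lemma kill_self (v : V) (g : V → ℝ≥0∞) : kill v g v = 0 := if_pos rfl

lemma kill_of_ne {u v : V} (h : u ≠ v) (g : V → ℝ≥0∞) : kill v g u = g u := if_neg h

open Classical in
/-- The indicator of not having visited `v` up to time `t`. -/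
def alive (v : V) (t : ℕ) (ω : ℕ → V) : ℝ≥0∞ := if ∀ i ≤ t, ω i ≠ v then 1 else 0

lemma alive_succ (v : V) (t : ℕ) (ω : ℕ → V) (g : V → ℝ≥0∞) :
    alive v (t + 1) ω * g (ω (t + 1)) = alive v t ω * kill v g (ω (t + 1)) := by
  unfold alive kill
  by_cases h : ω (t + 1) = v
  · have : ¬ ∀ i ≤ t + 1, ω i ≠ v := fun h' => h' _ le_rfl h
    simp [h, this]
  · have : (∀ i ≤ t + 1, ω i ≠ v) ↔ ∀ i ≤ t, ω i ≠ v := by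
      refine ⟨fun h' i hi => h' i (by omega), fun h' i hi => ?_⟩
      rcases Nat.lt_or_ge t i with h1 | h1
      · rwa [show i = t + 1 by omega]
      · exact h' i h1
    rw [if_neg h]
    congr 1
    by_cases h' : ∀ i ≤ t, ω i ≠ v
    · rw [if_pos h', if_pos (this.2 h')]
    · rw [if_neg h', if_neg fun h'' => h' (this.1 h'')]

lemma reachTime_eq_tsum (v : V) (ω : ℕ → V) : reachTime v ω = ∑' t, alive v t ω := by
  classical
  by_cases h : ∃ t, ω t = v
  · have hT := Nat.find_spec h
    set T := Nat.find h with hTdef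
    have hmin : ∀ i < T, ω i ≠ v := fun i hi => Nat.find_min h hi
    have h1 : reachTime v ω = T := by
      refine le_antisymm (iInf₂_le T hT) (le_iInf₂ fun t ht => ?_)
      exact_mod_cast Nat.find_min' h ht
    have h2 : ∀ t, alive v t ω = if t ∈ Finset.range T then 1 else 0 := by
      intro t
      unfold alive
      refine if_congr ?_ rfl rfl
      rw [Finset.mem_range]
      refine ⟨fun h' => ?_, fun h' i hi => hmin i (lt_of_le_of_lt hi h')⟩
      by_contra hc
      exact h' T (not_lt.1 hc) hT
    rw [h1, tsum_eq_sum (s := Finset.range T) fun t ht => by rw [h2, if_neg ht],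
      Finset.sum_congr rfl fun t ht => by rw [h2, if_pos ht]]
    simp
  · push Not at h
    have h1 : reachTime v ω = ⊤ := by simp [reachTime, h]
    have h2 : ∀ t, alive v t ω = 1 := fun t => if_pos fun i _ => h i
    rw [h1, tsum_congr h2]
    exact (ENNReal.tsum_const_eq_top_of_ne_zero one_ne_zero).symm

lemma measurable_alive [MeasurableSpace V] [DiscreteMeasurableSpace V] (v : V) (t : ℕ) : Measurable (alive v t) := by
  classical
  unfold alive
  refine Measurable.ite ?_ measurable_const measurable_const
  have : {ω : ℕ → V | ∀ i ≤ t, ω i ≠ v} = ⋂ i, ⋂ (_ : i ≤ t), (fun ω => ω i) ⁻¹' {v}ᶜ := by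
    ext; simp
  rw [this]
  exact MeasurableSet.iInter fun i => MeasurableSet.iInter fun _ =>
    measurable_pi_apply i (MeasurableSet.of_discrete)

end Alive

/-! ### The Laplace operator -/

section Laplace

variable {V : Type*} [Fintype V] (G : WGraph V)

/-- The Laplace operator `(Lf)(x) = ∑ w(x, y) (f(x) - f(y))`. -/
def lap (f : V → ℝ) (x : V) : ℝ := ∑ y, G.weight x y * (f x - f y)

lemma lap_eq (f : V → ℝ) (x : V) : G.lap f x = G.deg x * f x - ∑ y, G.weight x y * f y := by
  simp only [lap, mul_sub, Finset.sum_sub_distrib, deg, Finset.sum_mul]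

end Laplace

/-! ### Hitting times: Markov property, one-step equation, minimality -/

section HittingTime

open MeasureTheory ProbabilityTheory

variable {V : Type*} [Fintype V] [MeasurableSpace V] [DiscreteMeasurableSpace V] (G : WGraph V)

/-- The expectation of `g` after one step of the walk from `u`. -/
def avg (g : V → ℝ≥0∞) (u : V) : ℝ≥0∞ := ∫⁻ y, g y ∂(G.step u).toMeasure

lemma avg_eq_sum (g : V → ℝ≥0∞) (u : V) : G.avg g u = ∑ y, g y * G.step u y := by
  unfold avg
  rw [lintegral_fintype]
  refine Finset.sum_congr rfl fun y _ => ?_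
  rw [PMF.toMeasure_apply_singleton _ _ (measurableSet_singleton y)]

omit [DiscreteMeasurableSpace V] in
lemma avg_mono {f g : V → ℝ≥0∞} (h : f ≤ g) : G.avg f ≤ G.avg g := fun _ => lintegral_mono h

/-- The Markov property. Survival up to time `t` depends only on the trajectory up to `t`, and the
joint law of that initial segment with the next position is a composition product with `pathKernel
t`. -/
lemma lintegral_walkLaw_succ (u v : V) (t : ℕ) (g : V → ℝ≥0∞) :
    ∫⁻ ω, alive v t ω * g (ω (t + 1)) ∂G.walkLaw u =
      ∫⁻ ω, alive v t ω * G.avg g (ω t) ∂G.walkLaw u := by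
  classical
  have hg : Measurable g := Measurable.of_discrete
  have ha : Measurable (G.avg g) := Measurable.of_discrete
  let F : (Finset.Iic t → V) → ℝ≥0∞ := fun x => if ∀ i, x i ≠ v then 1 else 0
  have hF : Measurable F := Measurable.of_discrete
  have hFa : ∀ ω : ℕ → V, alive v t ω = F (Preorder.frestrictLe t ω) := by
    intro ω
    simp only [alive, F]
    refine if_congr ?_ rfl rfl
    simp [Preorder.frestrictLe]
  have key := Kernel.partialTraj_compProd_eq_map_traj (κ := G.pathKernel) (Nat.zero_le t)
    (X := fun _ => V)
    (x₀ := fun _ => u)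
  have hm1 := Kernel.traj_map_frestrictLe_apply (X := fun _ => V) (κ := G.pathKernel) 0 t (fun _ => u)
  unfold walkLaw
  have hΦ : Measurable fun x : ℕ → V => (Preorder.frestrictLe (π := fun _ => V) t x, x (t + 1)) :=
    (Preorder.measurable_frestrictLe t).prodMk (measurable_pi_apply _)
  have hFg : Measurable fun z : (Finset.Iic t → V) × V => F z.1 * g z.2 :=
    (hF.comp measurable_fst).mul (hg.comp measurable_snd)
  have h1 : ∫⁻ ω, alive v t ω * g (ω (t + 1)) ∂Kernel.traj (X := fun _ => V) G.pathKernel 0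
      (fun _ => u) = ∫⁻ z, F z.1 * g z.2 ∂(Kernel.traj (X := fun _ => V) G.pathKernel 0
        (fun _ => u)).map (fun x => (Preorder.frestrictLe (π := fun _ => V) t x, x (t + 1))) := by
    rw [lintegral_map hFg hΦ]
    exact lintegral_congr fun ω => by rw [hFa]
  rw [h1, ← key, Measure.lintegral_compProd hFg]
  have h2 : ∀ x, ∫⁻ y, F x * g y ∂G.pathKernel t x =
      F x * G.avg g (x ⟨t, Finset.mem_Iic.2 le_rfl⟩) := fun x => lintegral_const_mul _ hg
  simp only [h2]
  rw [← hm1, lintegral_map Measurable.of_discrete (Preorder.measurable_frestrictLe t)]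
  exact lintegral_congr fun ω => by rw [hFa]; rfl

lemma lintegral_alive (u v : V) (t : ℕ) (g : V → ℝ≥0∞) :
    ∫⁻ ω, alive v t ω * g (ω t) ∂G.walkLaw u =
      kill v ((fun f => G.avg (kill v f))^[t] g) u := by
  induction t generalizing g with
  | zero =>
    have hg : Measurable g := Measurable.of_discrete
    have hF : Measurable fun ω : ℕ → V => alive v 0 ω * g (ω 0) :=
      (measurable_alive v 0).mul (by fun_prop)
    rw [walkLaw, Kernel.lintegral_traj _ hF]
    have : ∀ ω : ℕ → V, alive v 0 (Function.updateFinset ω (Finset.Iic 0) fun _ => u) *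
        g (Function.updateFinset ω (Finset.Iic 0) (fun _ => u) 0) = kill v g u := by
      intro ω
      by_cases h : u = v <;> simp [alive, kill, Function.updateFinset, h]
    simp [this]
  | succ t ih =>
    simp_rw [alive_succ]
    rw [lintegral_walkLaw_succ, ih, Function.iterate_succ_apply]

/-- The expectation of the hitting time truncated at `T`. -/
def hitUpTo (v : V) : ℕ → V → ℝ≥0∞
  | 0 => 0
  | T + 1 => kill v (1 + G.avg (hitUpTo v T))

lemma hitUpTo_eq_sum (v : V) (T : ℕ) (u : V) : G.hitUpTo v T u =
    ∑ t ∈ Finset.range T, kill v ((fun f => G.avg (kill v f))^[t] 1) u := by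
  induction T generalizing u with
  | zero => simp [hitUpTo]
  | succ T ih =>
    rw [Finset.sum_range_succ']
    by_cases h : u = v
    · subst h; simp [hitUpTo]
    · simp only [hitUpTo, kill_of_ne h, Function.iterate_succ_apply', Function.iterate_zero, id,
        Pi.add_apply, Pi.one_apply]
      rw [add_comm]
      congr 1
      rw [funext ih]
      unfold avg
      exact lintegral_finsetSum _ fun _ _ => Measurable.of_discrete

lemma hit_eq_iSup (u v : V) : G.hit u v = ⨆ T, G.hitUpTo v T u := by
  have h1 : G.hit u v = ∑' t, kill v ((fun f => G.avg (kill v f))^[t] 1) u := by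
    unfold hit
    simp_rw [reachTime_eq_tsum]
    rw [lintegral_tsum fun t => (measurable_alive v t).aemeasurable]
    refine tsum_congr fun t => ?_
    simpa using G.lintegral_alive u v t 1
  rw [h1, ENNReal.tsum_eq_iSup_nat]
  exact iSup_congr fun T => (G.hitUpTo_eq_sum v T u).symm

lemma hitUpTo_mono (v u : V) : Monotone fun T => G.hitUpTo v T u := by
  intro S T h
  simp only [hitUpTo_eq_sum]
  exact Finset.sum_le_sum_of_subset (Finset.range_mono h)

lemma hit_self (v : V) : G.hit v v = 0 := by
  rw [hit_eq_iSup, ENNReal.iSup_eq_zero]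
  intro T
  cases T <;> simp [hitUpTo]

lemma hit_eq_one_add {u v : V} (h : u ≠ v) : G.hit u v = 1 + G.avg (fun y => G.hit y v) u := by
  have h1 : ∀ T, G.hitUpTo v (T + 1) u = 1 + G.avg (G.hitUpTo v T) u := fun T => by
    simp [hitUpTo, kill_of_ne h]
  have h2 : G.avg (fun y => G.hit y v) u = ⨆ T, G.avg (G.hitUpTo v T) u := by
    unfold avg
    simp_rw [hit_eq_iSup]
    exact lintegral_iSup (fun _ => Measurable.of_discrete) fun S T hST y => G.hitUpTo_mono v y hST
  rw [hit_eq_iSup, h2, ENNReal.add_iSup]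
  simp_rw [← h1]
  exact ((G.hitUpTo_mono v u).iSup_nat_add 1).symm

/-- Truncated hitting times start at zero and stay below every supersolution by induction, hence so
does their supremum. With a real-valued `f` this also proves finiteness. -/
lemma hit_le_of_supersolution (v : V) (f : V → ℝ≥0∞)
    (hf : ∀ u, u ≠ v → 1 + G.avg f u ≤ f u) (u : V) : G.hit u v ≤ f u := by
  rw [hit_eq_iSup]
  refine iSup_le fun T => ?_
  induction T generalizing u with
  | zero => simp [hitUpTo]
  | succ T ih =>
    by_cases h : u = v
    · subst h; simp [hitUpTo]
    · simp only [hitUpTo, kill_of_ne h, Pi.add_apply, Pi.one_apply]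
      exact (add_le_add_right (G.avg_mono ih u) 1).trans (hf u h)

lemma avg_ofReal {u : V} (hu : G.deg u ≠ 0) {f : V → ℝ} (hf : ∀ x, 0 ≤ f x) :
    G.avg (fun x => ENNReal.ofReal (f x)) u =
      ENNReal.ofReal ((∑ y, G.weight u y * f y) / G.deg u) := by
  rw [avg_eq_sum, Finset.sum_div, ENNReal.ofReal_sum_of_nonneg fun y _ =>
    div_nonneg (mul_nonneg (G.nonneg _ _) (hf y)) (G.deg_nonneg u)]
  refine Finset.sum_congr rfl fun y _ => ?_
  have : G.step u y = ENNReal.ofReal (G.weight u y / G.deg u) := by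
    simp [step, hu]
  rw [this, ← ENNReal.ofReal_mul (hf y)]
  congr 1
  ring

lemma one_add_avg_ofReal {u : V} (hu : 0 < G.deg u) {f : V → ℝ} (hf : ∀ x, 0 ≤ f x) :
    1 + G.avg (fun x => ENNReal.ofReal (f x)) u =
      ENNReal.ofReal (f u + (G.deg u - G.lap f u) / G.deg u) := by
  have h0 : 0 ≤ (∑ y, G.weight u y * f y) / G.deg u :=
    div_nonneg (Finset.sum_nonneg fun y _ => mul_nonneg (G.nonneg _ _) (hf y)) hu.le
  rw [avg_ofReal G hu.ne' hf, ← ENNReal.ofReal_one, ← ENNReal.ofReal_add zero_le_one h0, lap_eq]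
  congr 1
  field_simp
  ring

lemma hit_le_ofReal (v : V) (hd : ∀ x, 0 < G.deg x) (f : V → ℝ) (hf : ∀ x, 0 ≤ f x)
    (hL : ∀ x, x ≠ v → G.deg x ≤ G.lap f x) (u : V) : G.hit u v ≤ ENNReal.ofReal (f u) := by
  refine G.hit_le_of_supersolution v (fun x => ENNReal.ofReal (f x)) (fun u hu => ?_) u
  rw [one_add_avg_ofReal G (hd u) hf]
  refine ENNReal.ofReal_le_ofReal ?_
  have : (G.deg u - G.lap f u) / G.deg u ≤ 0 :=
    div_nonpos_of_nonpos_of_nonneg (sub_nonpos.2 (hL u hu)) (hd u).le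
  linarith

/-- The hitting time as a real number. -/
def hitR (v u : V) : ℝ := (G.hit u v).toReal

lemma hitR_nonneg (v u : V) : 0 ≤ G.hitR v u := ENNReal.toReal_nonneg

@[simp] lemma hitR_self (v : V) : G.hitR v v = 0 := by simp [hitR, hit_self]

lemma lap_hitR (v : V) (hd : ∀ x, 0 < G.deg x) (hfin : ∀ u, G.hit u v ≠ ⊤) {x : V} (hx : x ≠ v) :
    G.lap (G.hitR v) x = G.deg x := by
  have h1 : ∀ y, G.hit y v = ENNReal.ofReal (G.hitR v y) := fun y =>
    (ENNReal.ofReal_toReal (hfin y)).symm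
  have h2 := G.hit_eq_one_add hx
  rw [funext h1, one_add_avg_ofReal G (hd x) (G.hitR_nonneg v)] at h2
  rw [h1] at h2
  -- `ENNReal.ofReal` collapses negative numbers to zero, so both sides must be nonnegative before
  -- it can be cancelled.
  have h3 : 0 ≤ (G.deg x - G.lap (G.hitR v) x) / G.deg x + G.hitR v x := by
    rw [lap_eq]
    have : 0 ≤ ∑ y, G.weight x y * G.hitR v y :=
      Finset.sum_nonneg fun y _ => mul_nonneg (G.nonneg _ _) (G.hitR_nonneg _ _)
    have hdx := hd x
    rw [show (G.deg x - (G.deg x * G.hitR v x - ∑ y, G.weight x y * G.hitR v y)) / G.deg x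
      + G.hitR v x = 1 + (∑ y, G.weight x y * G.hitR v y) / G.deg x by field_simp; ring]
    positivity
  have h4 := (ENNReal.ofReal_eq_ofReal_iff (G.hitR_nonneg v x) (by linarith)).1 h2
  have h5 : (G.deg x - G.lap (G.hitR v) x) / G.deg x = 0 := by linarith
  have := (div_eq_zero_iff.1 h5).resolve_right (hd x).ne'
  linarith

end HittingTime

/-! ### The Dirichlet form -/

section DirichletForm

variable {V : Type*} [Fintype V] (G : WGraph V)

/-- The Dirichlet form of the graph. -/
def form (f g : V → ℝ) : ℝ := ∑ x, f x * G.lap g x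

lemma form_eq_half_sum (f g : V → ℝ) :
    G.form f g = (∑ x, ∑ y, G.weight x y * ((f x - f y) * (g x - g y))) / 2 := by
  have h1 : G.form f g = ∑ x, ∑ y, G.weight x y * (f x * (g x - g y)) := by
    simp only [form, lap, Finset.mul_sum]
    exact Finset.sum_congr rfl fun x _ => Finset.sum_congr rfl fun y _ => by ring
  have h2 : G.form f g = ∑ x, ∑ y, G.weight x y * (f y * (g y - g x)) := by
    rw [h1, Finset.sum_comm]
    exact Finset.sum_congr rfl fun x _ => Finset.sum_congr rfl fun y _ => by rw [G.symm]
  have h3 : G.form f g + G.form f g =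
      ∑ x, ∑ y, G.weight x y * ((f x - f y) * (g x - g y)) := by
    nth_rw 1 [h1]
    rw [h2, ← Finset.sum_add_distrib]
    refine Finset.sum_congr rfl fun x _ => ?_
    rw [← Finset.sum_add_distrib]
    exact Finset.sum_congr rfl fun y _ => by ring
  linarith

lemma form_comm (f g : V → ℝ) : G.form f g = G.form g f := by
  simp only [form_eq_half_sum]
  congr 1
  exact Finset.sum_congr rfl fun x _ => Finset.sum_congr rfl fun y _ => by ring

lemma form_self_nonneg (f : V → ℝ) : 0 ≤ G.form f f := by
  rw [form_eq_half_sum]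
  refine div_nonneg (Finset.sum_nonneg fun x _ => Finset.sum_nonneg fun y _ => ?_) zero_le_two
  exact mul_nonneg (G.nonneg _ _) (mul_self_nonneg _)

lemma form_sq_le (f g : V → ℝ) : G.form f g ^ 2 ≤ G.form f f * G.form g g := by
  simp only [form_eq_half_sum, ← Fintype.sum_prod_type']
  have h := Finset.sum_mul_sq_le_sq_mul_sq (Finset.univ : Finset (V × V))
    (fun z => √(G.weight z.1 z.2) * (f z.1 - f z.2))
    (fun z => √(G.weight z.1 z.2) * (g z.1 - g z.2))
  have hs : ∀ z : V × V, √(G.weight z.1 z.2) * √(G.weight z.1 z.2) = G.weight z.1 z.2 :=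
    fun z => Real.mul_self_sqrt (G.nonneg _ _)
  have h1 : ∀ a b : V → ℝ, ∀ z : V × V, √(G.weight z.1 z.2) * (a z.1 - a z.2) *
      (√(G.weight z.1 z.2) * (b z.1 - b z.2)) =
      G.weight z.1 z.2 * ((a z.1 - a z.2) * (b z.1 - b z.2)) := fun a b z => by
    rw [mul_mul_mul_comm, hs]
  simp only [sq, h1] at h ⊢
  linarith

lemma lap_sub (f g : V → ℝ) : G.lap (f - g) = G.lap f - G.lap g := by
  ext x
  simp only [lap, Pi.sub_apply, ← Finset.sum_sub_distrib]
  exact Finset.sum_congr rfl fun y _ => by ring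

lemma form_sub_right (f g h : V → ℝ) : G.form f (g - h) = G.form f g - G.form f h := by
  simp only [form, lap_sub, Pi.sub_apply, mul_sub, Finset.sum_sub_distrib]

lemma form_sub_const (f g : V → ℝ) (c d : ℝ) :
    G.form (fun x => f x - c) (fun x => g x - d) = G.form f g := by
  simp only [form_eq_half_sum, sub_sub_sub_cancel_right]

lemma sum_lap (g : V → ℝ) : ∑ x, G.lap g x = 0 := by
  have h : G.form (fun _ => 1) g = 0 := by simp [form_eq_half_sum]
  simpa [form] using h

open Classical in
lemma form_single (z : V) : G.form (Pi.single z 1) (Pi.single z 1) = G.deg z := by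
  unfold form
  rw [Finset.sum_eq_single z (fun x _ hx => by simp [Pi.single_eq_of_ne hx]) (by simp), lap_eq,
    Finset.sum_eq_single z (fun x _ hx => by simp [Pi.single_eq_of_ne hx]) (by simp)]
  simp [G.loopless]

/-- The sum of the degrees. -/
def vol : ℝ := ∑ x, G.deg x

lemma vol_nonneg : 0 ≤ G.vol := Finset.sum_nonneg fun x _ => G.deg_nonneg x

lemma form_le_of_lap_le {f : V → ℝ} {v : V} (hf : ∀ x, 0 ≤ f x) (hv : f v = 0)
    (hL : ∀ x, x ≠ v → G.lap f x ≤ G.deg x) {M : ℝ} (hM : ∀ x, f x ≤ M) :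
    G.form f f ≤ G.vol * M := by
  unfold form vol
  rw [Finset.sum_mul]
  refine Finset.sum_le_sum fun x _ => ?_
  by_cases hx : x = v
  · subst hx
    rw [hv, zero_mul]
    exact mul_nonneg (G.deg_nonneg _) (hv ▸ hM x)
  · rw [mul_comm]
    exact mul_le_mul (hL x hx) (hM x) (hf x) (G.deg_nonneg x)

/-- The indicator of a connected component has zero energy, so the bound forbids it to take two
values. -/
lemma connected_of_gap [Nonempty V] {ρ : ℝ}
    (hgap : ∀ (f : V → ℝ) (u v : V), (f u - f v) ^ 2 ≤ ρ * G.form f f) :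
    G.toSimpleGraph.Connected := by
  classical
  refine { preconnected := fun u v => ?_ }
  by_contra huv
  let f : V → ℝ := fun x => if G.toSimpleGraph.Reachable u x then 1 else 0
  have hE : G.form f f = 0 := by
    rw [form_eq_half_sum]
    have : ∀ x y, G.weight x y * ((f x - f y) * (f x - f y)) = 0 := by
      intro x y
      rcases (G.nonneg x y).eq_or_lt with h | h
      · rw [← h, zero_mul]
      · have hadj : G.toSimpleGraph.Adj x y := h
        have hiff : G.toSimpleGraph.Reachable u x ↔ G.toSimpleGraph.Reachable u y :=
          ⟨fun h => h.trans hadj.reachable, fun h => h.trans hadj.symm.reachable⟩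
        have : f x = f y := if_congr hiff rfl rfl
        rw [this]; ring
    simp [this]
  have h := hgap f u v
  rw [hE] at h
  simp [f, huv] at h
  linarith

end DirichletForm

/-! ### Hitting times and effective resistance -/

section Hitting

variable {V : Type*} [Fintype V] [MeasurableSpace V] [DiscreteMeasurableSpace V] (G : WGraph V)

/-- A truncated hitting time f vanishes at `v` and, being increasing in the truncation, satisfies L
f ≤ deg elsewhere. Hence its energy E is at most vol · max f, while max f ≤ √(ρE). Together these
give f ≤ vol · ρ, uniformly in the truncation. -/
lemma hit_ne_top_of_gap (hd : ∀ x, 0 < G.deg x) {ρ : ℝ} (hρ : 0 ≤ ρ)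
    (hgap : ∀ (f : V → ℝ) (u v : V), (f u - f v) ^ 2 ≤ ρ * G.form f f) (u v : V) :
    G.hit u v ≠ ⊤ := by
  have hbd : ∀ T u, G.hitUpTo v T u ≤ T := by
    intro T
    induction T with
    | zero => intro u; simp [hitUpTo]
    | succ T ih =>
      intro u
      by_cases h : u = v
      · subst h; simp [hitUpTo]
      · simp only [hitUpTo, kill_of_ne h, Pi.add_apply, Pi.one_apply]
        push_cast
        rw [add_comm]
        refine add_le_add_left ((G.avg_mono (g := fun _ => (T : ℝ≥0∞)) ih u).trans ?_) 1
        simp [avg]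
  have hmain : ∀ T, G.hitUpTo v T u ≤ ENNReal.ofReal (G.vol * ρ) := by
    intro T
    let f : V → ℝ := fun x => (G.hitUpTo v T x).toReal
    have hfin : ∀ x, G.hitUpTo v T x ≠ ⊤ := fun x => ne_top_of_le_ne_top (by simp) (hbd T x)
    have hf : ∀ x, 0 ≤ f x := fun x => ENNReal.toReal_nonneg
    have hfo : G.hitUpTo v T = fun x => ENNReal.ofReal (f x) :=
      funext fun x => (ENNReal.ofReal_toReal (hfin x)).symm
    have hv : f v = 0 := by
      cases T <;> simp [f, hitUpTo]
    have hL : ∀ x, x ≠ v → G.lap f x ≤ G.deg x := by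
      intro x hx
      have h1 : G.hitUpTo v T x ≤ G.hitUpTo v (T + 1) x := G.hitUpTo_mono v x T.le_succ
      have h2 : G.hitUpTo v (T + 1) x = 1 + G.avg (G.hitUpTo v T) x := by
        simp [hitUpTo, kill_of_ne hx]
      rw [h2, hfo, one_add_avg_ofReal G (hd x) hf] at h1
      by_contra hc
      push Not at hc
      have h3 : (G.deg x - G.lap f x) / G.deg x < 0 := div_neg_of_neg_of_pos (by linarith) (hd x)
      -- Where f vanishes, `ENNReal.ofReal` hides the strict inequality; there L f ≤ 0 holds
      -- directly because f ≥ 0.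
      rcases (hf x).eq_or_lt with h0 | h0
      · have : G.lap f x ≤ 0 := by
          rw [lap_eq, ← h0]
          have : 0 ≤ ∑ y, G.weight x y * f y :=
            Finset.sum_nonneg fun y _ => mul_nonneg (G.nonneg _ _) (hf y)
          linarith
        linarith [hd x]
      · have := (ENNReal.ofReal_lt_ofReal_iff h0).2
          (show f x + (G.deg x - G.lap f x) / G.deg x < f x by linarith)
        exact absurd h1 (not_le.2 this)
    set E := G.form f f with hE
    have hE0 : 0 ≤ E := G.form_self_nonneg f
    have hsq : ∀ x, f x ^ 2 ≤ ρ * E := fun x => by simpa [hv] using hgap f x v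
    have hρE : 0 ≤ ρ * E := (sq_nonneg _).trans (hsq v)
    have hle : ∀ x, f x ≤ √(ρ * E) := fun x => Real.le_sqrt_of_sq_le (hsq x)
    have h1 : E ≤ G.vol * √(ρ * E) := G.form_le_of_lap_le hf hv hL hle
    have hss := Real.mul_self_sqrt hρE
    have hs0 := Real.sqrt_nonneg (ρ * E)
    have hvol := G.vol_nonneg
    rw [hfo]
    refine ENNReal.ofReal_le_ofReal ((hle u).trans ?_)
    rcases hs0.eq_or_lt with h0 | h0
    · rw [← h0]
      positivity
    · have : √(ρ * E) * √(ρ * E) ≤ (G.vol * ρ) * √(ρ * E) := by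
        rw [hss]
        calc ρ * E ≤ ρ * (G.vol * √(ρ * E)) := mul_le_mul_of_nonneg_left h1 hρ
          _ = _ := by ring
      exact le_of_mul_le_mul_right this h0
  rw [hit_eq_iSup]
  exact ne_top_of_le_ne_top ENNReal.ofReal_ne_top (iSup_le hmain)

variable {G}

lemma lap_hitR_self {v : V} (hd : ∀ x, 0 < G.deg x) (hfin : ∀ u, G.hit u v ≠ ⊤) :
    G.lap (G.hitR v) v = G.deg v - G.vol := by
  classical
  have h := G.sum_lap (G.hitR v)
  rw [← Finset.add_sum_erase _ _ (Finset.mem_univ v),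
    Finset.sum_congr rfl fun x hx => G.lap_hitR v hd hfin (Finset.ne_of_mem_erase hx)] at h
  have h2 := Finset.add_sum_erase Finset.univ G.deg (Finset.mem_univ v)
  unfold vol
  linarith

lemma form_hitR {v : V} (hd : ∀ x, 0 < G.deg x) (hfin : ∀ u, G.hit u v ≠ ⊤) (f : V → ℝ) :
    G.form f (G.hitR v) = ∑ x, f x * G.deg x - G.vol * f v := by
  classical
  have h : ∀ x, f x * G.lap (G.hitR v) x = f x * G.deg x - if x = v then G.vol * f v else 0 := by
    intro x
    by_cases hx : x = v
    · subst hx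
      rw [lap_hitR_self hd hfin, if_pos rfl]; ring
    · rw [G.lap_hitR v hd hfin hx, if_neg hx, sub_zero]
  simp [form, h]

/-- The function φ below represents g ↦ vol · (g u - g v) in the form, and φ u - φ v is the commute
time, at most 2H. Cauchy–Schwarz against φ gives the claim. -/
lemma gap_of_hit_le (hd : ∀ x, 0 < G.deg x) (hfin : ∀ u v, G.hit u v ≠ ⊤) {H : ℝ}
    (hH : ∀ u v, G.hitR v u ≤ H) (f : V → ℝ) (u v : V) :
    (f u - f v) ^ 2 ≤ 2 * H / G.vol * G.form f f := by
  have hvp : 0 < G.vol := Finset.sum_pos (fun x _ => hd x) ⟨u, Finset.mem_univ _⟩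
  set φ := G.hitR v - G.hitR u with hφ
  have h1 : ∀ g, G.form g φ = G.vol * (g u - g v) := fun g => by
    rw [hφ, form_sub_right, form_hitR hd fun x => hfin x v, form_hitR hd fun x => hfin x u]
    ring
  have h2 := G.form_sq_le f φ
  rw [h1, h1] at h2
  have h3 : φ u - φ v ≤ 2 * H := by
    simp only [hφ, Pi.sub_apply, hitR_self]
    linarith [hH u v, hH v u]
  have h4 : (G.vol * (f u - f v)) ^ 2 ≤ G.form f f * (G.vol * (2 * H)) :=
    h2.trans (mul_le_mul_of_nonneg_left (mul_le_mul_of_nonneg_left h3 hvp.le)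
      (G.form_self_nonneg f))
  rw [div_mul_eq_mul_div, le_div_iff₀ hvp]
  refine le_of_mul_le_mul_left ?_ hvp
  linarith

end Hitting

/-! ### Stability of hitting times under perturbation of the form -/

section Perturbation

variable {V : Type*} [Fintype V] {G G' : WGraph V} {ε : ℝ}

lemma abs_form_sub_le (hε : 0 ≤ ε)
    (hB : ∀ f g, (G'.form f g - G.form f g) ^ 2 ≤ ε ^ 2 * (G.form f f * G.form g g))
    (f g : V → ℝ) : |G'.form f g - G.form f g| ≤ ε * (√(G.form f f) * √(G.form g g)) := by
  rw [← Real.sqrt_mul (G.form_self_nonneg f)]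
  refine abs_le_of_sq_le_sq ?_ (by positivity)
  rw [mul_pow, Real.sq_sqrt (mul_nonneg (G.form_self_nonneg f) (G.form_self_nonneg g))]
  exact hB f g

lemma abs_form_self_sub_le (hε : 0 ≤ ε)
    (hB : ∀ f g, (G'.form f g - G.form f g) ^ 2 ≤ ε ^ 2 * (G.form f f * G.form g g))
    (f : V → ℝ) : |G'.form f f - G.form f f| ≤ ε * G.form f f := by
  simpa [Real.mul_self_sqrt (G.form_self_nonneg f)] using abs_form_sub_le hε hB f f

lemma abs_deg_sub_le (hε : 0 ≤ ε)
    (hB : ∀ f g, (G'.form f g - G.form f g) ^ 2 ≤ ε ^ 2 * (G.form f f * G.form g g))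
    (z : V) : |G'.deg z - G.deg z| ≤ ε * G.deg z := by
  classical
  simpa [form_single] using abs_form_self_sub_le hε hB (Pi.single z 1)

variable [MeasurableSpace V] [DiscreteMeasurableSpace V]

/-- An energy estimate for the difference f of the two hitting times. Here `q` is the energy norm of
f, `r` bounds |f| by `r * q` through the resistance, and `k` bounds the energy norm of h. -/
theorem abs_hitR_sub_le (hε : 0 ≤ ε) (hε2 : ε ≤ 1 / 2)
    (hB : ∀ f g, (G'.form f g - G.form f g) ^ 2 ≤ ε ^ 2 * (G.form f f * G.form g g))
    (hd : ∀ x, 0 < G.deg x) (hfin : ∀ u v, G.hit u v ≠ ⊤) {H : ℝ}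
    (hH : ∀ u v, G.hitR v u ≤ H) (hd' : ∀ x, 0 < G'.deg x) (hfin' : ∀ u v, G'.hit u v ≠ ⊤)
    (u v : V) : |G.hitR v u - G'.hitR v u| ≤ 8 * ε * H := by
  have hvp : 0 < G.vol := Finset.sum_pos (fun x _ => hd x) ⟨u, Finset.mem_univ _⟩
  have hH0 : 0 ≤ H := (G.hitR_nonneg v u).trans (hH u v)
  set h := G.hitR v
  set f := h - G'.hitR v with hf
  have hfv : f v = 0 := by simp [hf, h]
  set q := √(G.form f f)
  set r := √(2 * H / G.vol)
  set k := √(H * G.vol)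
  have hq0 : 0 ≤ q := Real.sqrt_nonneg _
  have hr0 : 0 ≤ r := Real.sqrt_nonneg _
  have hk0 : 0 ≤ k := Real.sqrt_nonneg _
  have hqq : q * q = G.form f f := Real.mul_self_sqrt (G.form_self_nonneg f)
  have hrk : r * k = √2 * H := by
    simp only [r, k]
    rw [← Real.sqrt_mul (by positivity), show 2 * H / G.vol * (H * G.vol) = 2 * (H * H) by
      field_simp, Real.sqrt_mul zero_le_two, Real.sqrt_mul_self hH0]
  have hrv : r * G.vol = √2 * k := by
    simp only [r, k]
    rw [← Real.sqrt_mul zero_le_two]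
    nth_rw 2 [← Real.sqrt_mul_self hvp.le]
    rw [← Real.sqrt_mul (by positivity)]
    congr 1
    field_simp
  have hfx : ∀ x, |f x| ≤ r * q := fun x => by
    rw [← Real.sqrt_mul (by positivity)]
    refine Real.le_sqrt_of_sq_le ?_
    simpa [hfv, sq_abs] using gap_of_hit_le hd hfin hH f x v
  have hhh : √(G.form h h) ≤ k := by
    refine Real.sqrt_le_sqrt ?_
    rw [mul_comm]
    exact G.form_le_of_lap_le (G.hitR_nonneg v) (G.hitR_self v)
      (fun x hx => (G.lap_hitR v hd (fun u => hfin u v) hx).le) fun x => hH x v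
  -- Since f vanishes at `v`, the point masses in the equations for h and h' drop out. Only the
  -- change of the form and the change of the degrees remain, and both are of order ε.
  have hE' : G'.form f f = (G'.form f h - G.form f h) + ∑ x, f x * (G.deg x - G'.deg x) := by
    have h1 : G'.form f f = G'.form f h - G'.form f (G'.hitR v) := by
      rw [← form_sub_right]
    have h2 : G.form f h = ∑ x, f x * G.deg x := by
      rw [form_hitR hd fun x => hfin x v, hfv]; ring
    rw [h1, form_hitR hd' fun x => hfin' x v, hfv, h2]
    simp only [mul_sub, Finset.sum_sub_distrib]
    ring
  have hA : G'.form f h - G.form f h ≤ ε * (q * k) :=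
    (le_abs_self _).trans ((abs_form_sub_le hε hB f h).trans (by gcongr))
  have hD : ∑ x, f x * (G.deg x - G'.deg x) ≤ ε * (r * G.vol) * q := by
    have : ε * (r * G.vol) * q = ∑ x, (r * q) * (ε * G.deg x) := by
      rw [← Finset.mul_sum, ← Finset.mul_sum]; unfold vol; ring
    rw [this]
    refine Finset.sum_le_sum fun x _ => (le_abs_self _).trans ?_
    rw [abs_mul, abs_sub_comm]
    exact mul_le_mul (hfx x) (abs_deg_sub_le hε hB x) (abs_nonneg _) (by positivity)
  have hlow := (abs_le.1 (abs_form_self_sub_le hε hB f)).1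
  have hs2 : √2 ≤ 3 / 2 := Real.sqrt_le_iff.2 ⟨by norm_num, by norm_num⟩
  have hs2' : √2 * √2 = 2 := Real.mul_self_sqrt zero_le_two
  -- As ε ≤ 1/2, the left side of `hE'` is at least q²/2; the right side is at most ε q k (1 + √2).
  have hqq2 : q * q ≤ (2 * ε * k * (1 + √2)) * q := by
    rw [hrv] at hD
    nlinarith [G.form_self_nonneg f]
  have hq : q ≤ 2 * ε * k * (1 + √2) := by
    rcases hq0.eq_or_lt with h0 | h0
    · rw [← h0]; positivity
    · exact le_of_mul_le_mul_right hqq2 h0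
  calc |h u - G'.hitR v u| = |f u| := rfl
    _ ≤ r * q := hfx u
    _ ≤ r * (2 * ε * k * (1 + √2)) := by gcongr
    _ = 2 * ε * (r * k) * (1 + √2) := by ring
    _ = 2 * (√2 + √2 * √2) * (ε * H) := by rw [hrk]; ring
    _ ≤ 8 * (ε * H) := by
      refine mul_le_mul_of_nonneg_right ?_ (by positivity)
      linarith
    _ = 8 * ε * H := by ring

theorem gap_of_form_close (hε : 0 ≤ ε) (hε2 : ε ≤ 1 / 2)
    (hB : ∀ f g, (G'.form f g - G.form f g) ^ 2 ≤ ε ^ 2 * (G.form f f * G.form g g))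
    (hd : ∀ x, 0 < G.deg x) (hfin : ∀ u v, G.hit u v ≠ ⊤) {H : ℝ}
    (hH : ∀ u v, G.hitR v u ≤ H) (f : V → ℝ) (u v : V) :
    (f u - f v) ^ 2 ≤ 2 * (2 * H / G.vol) * G'.form f f := by
  have hH0 : 0 ≤ H := (G.hitR_nonneg v u).trans (hH u v)
  have h1 := (abs_le.1 (abs_form_self_sub_le hε hB f)).1
  have h2 : G.form f f ≤ 2 * G'.form f f := by nlinarith [G.form_self_nonneg f]
  have h3 : 0 ≤ 2 * H / G.vol := div_nonneg (by positivity) G.vol_nonneg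
  calc _ ≤ 2 * H / G.vol * G.form f f := gap_of_hit_le hd hfin hH f u v
    _ ≤ 2 * H / G.vol * (2 * G'.form f f) := mul_le_mul_of_nonneg_left h2 h3
    _ = _ := by ring

end Perturbation

/-! ### Sums over edges and the form of the sparsified graph -/

section EdgeSums

variable {V : Type*} [Fintype V] (G : WGraph V)

variable {G}

omit [Fintype V] in
lemma Edge.mk_eq (e : G.Edge) : s(e.pos, e.neg) = e.1 := by
  have h1 : (Quot.out e.1 : V × V) = (e.pos, e.neg) := rfl
  rw [← Quot.out_eq e.1, h1]

omit [Fintype V] in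
lemma Edge.wt_pos (e : G.Edge) : 0 < e.wt := by
  have h := e.2
  rw [← e.mk_eq, SimpleGraph.mem_edgeSet] at h
  exact h

variable (G) in
lemma sum_weight_eq_sum_edge (F : V → V → ℝ) (hF : ∀ x y, F x y = F y x) :
    ∑ x, ∑ y, G.weight x y * F x y = 2 * ∑ e : G.Edge, e.wt * F e.pos e.neg := by
  classical
  have h1 : ∀ z : V × V, G.weight z.1 z.2 * F z.1 z.2 =
      ∑ e : G.Edge, if s(z.1, z.2) = e.1 then G.weight z.1 z.2 * F z.1 z.2 else 0 := by
    intro z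
    by_cases hz : 0 < G.weight z.1 z.2
    · let e₀ : G.Edge := ⟨s(z.1, z.2), hz⟩
      rw [Finset.sum_eq_single e₀ (fun e _ he => if_neg fun h => he (Subtype.ext h.symm))
        (by simp), if_pos rfl]
    · have : G.weight z.1 z.2 = 0 := le_antisymm (not_lt.1 hz) (G.nonneg _ _)
      simp [this]
  have h2 : ∀ e : G.Edge, (∑ z : V × V, if s(z.1, z.2) = e.1 then
      G.weight z.1 z.2 * F z.1 z.2 else 0) = 2 * (e.wt * F e.pos e.neg) := by
    intro e
    have hne : (e.pos, e.neg) ≠ (e.neg, e.pos) := fun h => e.pos_ne_neg (Prod.ext_iff.1 h).1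
    have hfil : (Finset.univ.filter fun z : V × V => s(z.1, z.2) = e.1) =
        {(e.pos, e.neg), (e.neg, e.pos)} := by
      ext z
      rw [Finset.mem_filter, ← e.mk_eq]
      simp [Prod.ext_iff]
    rw [← Finset.sum_filter, hfil, Finset.sum_pair hne]
    simp only [Edge.wt]
    rw [G.symm e.neg e.pos, hF e.neg e.pos]
    ring
  rw [← Fintype.sum_prod_type' (f := fun x y => G.weight x y * F x y),
    Finset.sum_congr rfl fun z _ => h1 z, Finset.sum_comm, Finset.sum_congr rfl fun e _ => h2 e,
    Finset.mul_sum]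

/-- The difference of a function along an edge. -/
def Edge.diff (e : G.Edge) (f : V → ℝ) : ℝ := f e.pos - f e.neg

variable (G) in
lemma form_eq_sum_edge (f g : V → ℝ) :
    G.form f g = ∑ e : G.Edge, e.wt * (e.diff f * e.diff g) := by
  rw [form_eq_half_sum, G.sum_weight_eq_sum_edge (fun x y => (f x - f y) * (g x - g y))
    fun x y => by ring]
  simp only [Edge.diff]
  ring

variable (G) in
/-- The sum of the edge weights. -/
def totalWeight : ℝ := ∑ e : G.Edge, e.wt

variable (G) in
lemma vol_eq : G.vol = 2 * G.totalWeight := by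
  have h := G.sum_weight_eq_sum_edge (fun _ _ => 1) fun _ _ => rfl
  simpa [vol, deg, totalWeight] using h

lemma sum_incidence_mul (e : G.Edge) (f : V → ℝ) :
    ∑ x, G.incidence e x * f x = e.diff f := by
  classical
  have h : ∀ x, G.incidence e x * f x =
      (if x = e.pos then f x else 0) - (if x = e.neg then f x else 0) := by
    intro x
    unfold incidence
    have := e.pos_ne_neg
    split_ifs <;> simp_all
  simp [h, Finset.sum_sub_distrib, Edge.diff]

lemma rowProb_eq (e : G.Edge) : G.rowProb e = e.wt / G.totalWeight := by
  classical
  have h : ∀ e : G.Edge, ∑ x, G.sqrtWB e x ^ 2 = 2 * e.wt := by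
    intro e
    have h1 : ∀ x, G.sqrtWB e x ^ 2 = e.wt * (G.incidence e x * G.incidence e x) := fun x => by
      rw [sqrtWB, mul_pow, Real.sq_sqrt e.wt_pos.le, sq]
    have h2 := e.pos_ne_neg
    rw [Finset.sum_congr rfl fun x _ => h1 x, ← Finset.mul_sum, sum_incidence_mul, Edge.diff,
      incidence, incidence, if_pos rfl, if_neg h2.symm, if_pos rfl]
    ring
  rw [rowProb, h, Finset.sum_congr rfl fun e _ => h e, ← Finset.mul_sum]
  exact mul_div_mul_left _ _ two_ne_zero

lemma totalWeight_pos [Nonempty G.Edge] : 0 < G.totalWeight :=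
  Finset.sum_pos (fun e _ => e.wt_pos) Finset.univ_nonempty

lemma rowProb_pos (e : G.Edge) : 0 < G.rowProb e := by
  have : Nonempty G.Edge := ⟨e⟩
  rw [rowProb_eq]
  exact div_pos e.wt_pos totalWeight_pos

lemma sum_rowProb [Nonempty G.Edge] : ∑ e, G.rowProb e = 1 := by
  simp only [rowProb_eq, ← Finset.sum_div]
  exact div_self totalWeight_pos.ne'

variable (G) in
lemma form_eq_sum_laplacian (f g : V → ℝ) :
    G.form f g = ∑ x, ∑ y, f x * (G.laplacian x y * g y) := by
  classical
  unfold form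
  refine Finset.sum_congr rfl fun x _ => ?_
  rw [← Finset.mul_sum, lap_eq]
  congr 1
  simp [laplacian, sub_mul, Finset.sum_sub_distrib, Matrix.diagonal_apply]

/-- Sampling is proportional to weight, so rescaling cancels the weight of the sampled edge and
every sample enters with the same factor. -/
lemma form_sparsify {s : ℕ} (σ : Fin s → G.Edge) (f g : V → ℝ) :
    (sparsify σ).form f g =
      G.totalWeight / s * ∑ j, (σ j).diff f * (σ j).diff g := by
  have h1 : ∀ (j : Fin s) (f : V → ℝ), ∑ x, f x * sampledRows σ j x =
      √(σ j).wt / √(G.rowProb (σ j) * s) * (σ j).diff f := by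
    intro j f
    rw [← sum_incidence_mul, Finset.mul_sum]
    refine Finset.sum_congr rfl fun x _ => ?_
    simp only [sampledRows, sqrtWB]
    ring
  rw [form_eq_sum_laplacian, laplacian_sparsify]
  calc ∑ x, ∑ y, f x * (sampledGram σ x y * g y)
      = ∑ x, ∑ y, ∑ j, (f x * sampledRows σ j x) * (g y * sampledRows σ j y) := by
        refine Finset.sum_congr rfl fun x _ => Finset.sum_congr rfl fun y _ => ?_
        simp only [sampledGram, Matrix.mul_apply, Matrix.transpose_apply]
        rw [Finset.sum_mul, Finset.mul_sum]
        exact Finset.sum_congr rfl fun j _ => by ring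
    _ = ∑ j, (∑ x, f x * sampledRows σ j x) * ∑ y, g y * sampledRows σ j y := by
        simp only [Finset.sum_mul_sum]
        rw [Finset.sum_comm' (t' := Finset.univ) (s' := fun _ => Finset.univ) (by simp)]
        rw [Finset.sum_congr rfl fun y _ => Finset.sum_comm, Finset.sum_comm]
        exact Finset.sum_congr rfl fun j _ => Finset.sum_comm
    _ = _ := by
        rw [Finset.mul_sum]
        refine Finset.sum_congr rfl fun j _ => ?_
        have : Nonempty G.Edge := ⟨σ j⟩
        have hW := totalWeight_pos (G := G)
        have hw := (σ j).wt_pos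
        have hs : (0 : ℝ) < s := by exact_mod_cast j.pos
        rw [h1, h1, mul_mul_mul_comm, ← sq, div_pow, Real.sq_sqrt hw.le, Real.sq_sqrt
          (mul_nonneg (rowProb_pos _).le hs.le), rowProb_eq]
        field_simp

lemma ncard_edgeSet_sparsify_le {s : ℕ} (σ : Fin s → G.Edge) :
    (sparsify σ).toSimpleGraph.edgeSet.ncard ≤ s := by
  classical
  have hsub : (sparsify σ).toSimpleGraph.edgeSet ⊆ Set.range fun j => (σ j).1 := by
    intro z hz
    induction z with
    | _ x y =>
    have hxy : 0 < (sparsify σ).weight x y := hz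
    have hne : x ≠ y := (SimpleGraph.mem_edgeSet _).1 hz |>.ne
    by_contra hc
    have h0 : sampledGram σ x y = 0 := by
      simp only [sampledGram, Matrix.mul_apply, Matrix.transpose_apply]
      refine Finset.sum_eq_zero fun j _ => ?_
      have hj : (σ j).1 ≠ s(x, y) := fun h => hc ⟨j, h⟩
      rw [← (σ j).mk_eq] at hj
      have : G.incidence (σ j) x = 0 ∨ G.incidence (σ j) y = 0 := by
        unfold incidence
        by_contra hcon
        push Not at hcon
        obtain ⟨ha, hb⟩ := hcon
        have hx : x = (σ j).pos ∨ x = (σ j).neg := by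
          by_contra h; push Not at h; simp [h.1, h.2] at ha
        have hy : y = (σ j).pos ∨ y = (σ j).neg := by
          by_contra h; push Not at h; simp [h.1, h.2] at hb
        rcases hx with hx | hx <;> rcases hy with hy | hy
        · exact hne (hx.trans hy.symm)
        · exact hj (by rw [hx, hy])
        · exact hj (by rw [hx, hy, Sym2.eq_swap])
        · exact hne (hx.trans hy.symm)
      rcases this with h | h <;> simp [sampledRows, sqrtWB, h]
    simp [sparsify, hne, h0] at hxy
  calc _ ≤ (Set.range fun j => (σ j).1).ncard := Set.ncard_le_ncard hsub (Set.finite_range _)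
    _ ≤ (Set.univ : Set (Fin s)).ncard := by
      rw [← Set.image_univ]; exact Set.ncard_image_le
    _ = s := by simp

end EdgeSums

/-! ### Second moment of the sampling error -/

section SecondMoment

open MeasureTheory ProbabilityTheory

variable {V : Type*} [Fintype V] {G : WGraph V}

lemma integral_edgeLaw (h : G.Edge → ℝ) : ∫ e, h e ∂G.edgeLaw = ∑ e, G.rowProb e * h e := by
  unfold edgeLaw
  rw [integral_finsetSum_measure fun e _ => (integrable_dirac (by simp)).smul_measure (by simp)]
  refine Finset.sum_congr rfl fun e _ => ?_
  rw [integral_smul_measure, integral_dirac, ENNReal.toReal_ofReal (rowProb_pos e).le,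
    smul_eq_mul]

instance [Nonempty G.Edge] : IsProbabilityMeasure G.edgeLaw := by
  refine ⟨?_⟩
  simp only [edgeLaw, Measure.coe_finsetSum, Finset.sum_apply, Measure.smul_apply, measure_univ,
    smul_eq_mul, mul_one]
  rw [← ENNReal.ofReal_sum_of_nonneg fun e _ => (rowProb_pos e).le, sum_rowProb,
    ENNReal.ofReal_one]

instance [Nonempty G.Edge] (s : ℕ) : IsProbabilityMeasure (G.sampleLaw s) := by
  unfold sampleLaw; infer_instance

/-- The estimator is unbiased, so the left side is its variance. Independence makes the variances of
the samples add up, and each is at most a second moment. -/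
lemma integral_sq_sample_sub_le [Nonempty G.Edge] {s : ℕ} (hs : 0 < s) (h : G.Edge → ℝ) :
    ∫ σ, (G.totalWeight / s * ∑ j, h (σ j) - ∑ e, e.wt * h e) ^ 2 ∂G.sampleLaw s ≤
      G.totalWeight / s * ∑ e, e.wt * h e ^ 2 := by
  have hW := totalWeight_pos (G := G)
  have hs' : (0 : ℝ) < s := by exact_mod_cast hs
  have hmem : MemLp h 2 G.edgeLaw := MemLp.of_discrete
  have hmean : ∀ g : G.Edge → ℝ, ∑ e : G.Edge, e.wt * g e = G.totalWeight * ∫ e, g e ∂G.edgeLaw := by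
    intro g
    rw [integral_edgeLaw, Finset.mul_sum]
    refine Finset.sum_congr rfl fun e _ => ?_
    rw [rowProb_eq]; field_simp
  have hint : ∀ j : Fin s, Integrable (fun σ : Fin s → G.Edge => h (σ j)) (G.sampleLaw s) :=
    fun j => Integrable.of_finite
  have hEj : ∀ j : Fin s, ∫ σ, h (σ j) ∂G.sampleLaw s = ∫ e, h e ∂G.edgeLaw := fun j =>
    integral_comp_eval (μ := fun _ : Fin s => G.edgeLaw) (i := j)
      (Measurable.of_discrete.aestronglyMeasurable)
  have hE : ∫ σ, ∑ j, h (σ j) ∂G.sampleLaw s = s * ∫ e, h e ∂G.edgeLaw := by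
    rw [integral_finsetSum _ fun j _ => hint j, Finset.sum_congr rfl fun j _ => hEj j]
    simp
  have hvar : Var[fun σ : Fin s → G.Edge => ∑ j, h (σ j); G.sampleLaw s] =
      s * Var[h; G.edgeLaw] := by
    have := variance_sum_pi (μ := fun _ : Fin s => G.edgeLaw) (X := fun _ => h) fun _ => hmem
    simp only [Finset.sum_const, Finset.card_univ, Fintype.card_fin, nsmul_eq_mul] at this
    rw [← this]
    congr 1
    ext σ
    simp
  have hvle : Var[h; G.edgeLaw] ≤ ∫ e, h e ^ 2 ∂G.edgeLaw :=
    variance_le_expectation_sq Measurable.of_discrete.aestronglyMeasurable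
  calc _ = ∫ σ, (G.totalWeight / s) ^ 2 * (∑ j, h (σ j) - ∫ σ', ∑ j, h (σ' j) ∂G.sampleLaw s) ^ 2
        ∂G.sampleLaw s := by
        refine integral_congr_ae (ae_of_all _ fun σ => ?_)
        simp only
        rw [hE, hmean]
        field_simp
    _ = (G.totalWeight / s) ^ 2 * Var[fun σ : Fin s → G.Edge => ∑ j, h (σ j); G.sampleLaw s] := by
        rw [integral_const_mul, variance_eq_integral Measurable.of_discrete.aemeasurable]
    _ ≤ (G.totalWeight / s) ^ 2 * (s * ∫ e, h e ^ 2 ∂G.edgeLaw) := by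
        rw [hvar]; gcongr
    _ = _ := by
        rw [hmean]; field_simp

end SecondMoment

/-! ### Orthonormal bases of positive definite forms -/

section Basis

lemma exists_orthonormal_basis {V : Type*} [Fintype V] (B : LinearMap.BilinForm ℝ (V → ℝ))
    (hsymm : ∀ f g, B f g = B g f) (hpos : ∀ f, f ≠ 0 → 0 < B f f) :
    ∃ b : Module.Basis (Fin (Fintype.card V)) ℝ (V → ℝ),
      ∀ i j, B (b i) (b j) = if i = j then 1 else 0 := by
  obtain ⟨v₀, hv₀⟩ := LinearMap.BilinForm.exists_orthogonal_basis ⟨hsymm⟩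
  have hcard : Module.finrank ℝ (V → ℝ) = Fintype.card V := Module.finrank_fintype_fun_eq_card ℝ
  let v := v₀.reindex (finCongr hcard)
  have hv : ∀ i j, i ≠ j → B (v i) (v j) = 0 := by
    intro i j hij
    simp only [v, Module.Basis.reindex_apply]
    exact hv₀ fun h => hij ((finCongr hcard).symm.injective h)
  have hp : ∀ i, 0 < √(B (v i) (v i)) := fun i => Real.sqrt_pos.2 (hpos _ (v.ne_zero i))
  refine ⟨v.isUnitSMul (w := fun i => (√(B (v i) (v i)))⁻¹)
    fun i => (inv_pos.2 (hp i)).ne'.isUnit, fun i j => ?_⟩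
  simp only [Module.Basis.isUnitSMul_apply, map_smul, LinearMap.smul_apply, smul_eq_mul]
  by_cases hij : i = j
  · subst hij
    have h := Real.mul_self_sqrt (hpos _ (v.ne_zero i)).le
    have := (hp i).ne'
    rw [if_pos rfl]
    nth_rw 3 [← h]
    field_simp
  · rw [hv i j hij, if_neg hij]; ring

end Basis

/-! ### Concentration of the sampled form -/

section Concentration

open MeasureTheory ProbabilityTheory

variable {V : Type*} [Fintype V] (G : WGraph V)

/-- The Dirichlet form as a bilinear form. -/
def bilin : LinearMap.BilinForm ℝ (V → ℝ) :=
  LinearMap.mk₂ ℝ G.form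
    (fun f f' g => by simp only [form, Pi.add_apply, add_mul, Finset.sum_add_distrib])
    (fun c f g => by simp only [form, Pi.smul_apply, smul_eq_mul, mul_assoc, Finset.mul_sum])
    (fun f g g' => by
      rw [G.form_comm f, G.form_comm f, G.form_comm f]
      simp only [form, Pi.add_apply, add_mul, Finset.sum_add_distrib])
    (fun c f g => by
      rw [G.form_comm f, G.form_comm f]
      simp only [form, Pi.smul_apply, smul_eq_mul, mul_assoc, Finset.mul_sum])

lemma bilin_apply (f g : V → ℝ) : G.bilin f g = G.form f g := rfl

/-- The Dirichlet form plus a rank-one term that makes it positive definite. -/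
def pinned (v : V) : LinearMap.BilinForm ℝ (V → ℝ) :=
  G.bilin + (LinearMap.mul ℝ ℝ).compl₁₂ (LinearMap.proj v) (LinearMap.proj v)

lemma pinned_apply (v : V) (f g : V → ℝ) : G.pinned v f g = G.form f g + f v * g v := rfl

variable {G}

lemma pinned_pos {ρ : ℝ} (hgap : ∀ (f : V → ℝ) (u v : V), (f u - f v) ^ 2 ≤ ρ * G.form f f)
    (v : V) (f : V → ℝ) (hf : f ≠ 0) : 0 < G.pinned v f f := by
  rw [pinned_apply]
  have h1 := G.form_self_nonneg f
  have h2 := mul_self_nonneg (f v)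
  refine lt_of_le_of_ne (by positivity) fun h => hf ?_
  have h3 : G.form f f = 0 := by linarith
  have h4 : f v = 0 := mul_self_eq_zero.1 (by linarith)
  ext x
  have h5 := hgap f x v
  rw [h3, h4, sub_zero, mul_zero] at h5
  exact pow_eq_zero_iff two_ne_zero |>.1 (le_antisymm h5 (sq_nonneg _))

omit [Fintype V] in
lemma apply_sum_basis {ι : Type*} [Fintype ι] (B : LinearMap.BilinForm ℝ (V → ℝ))
    (b : Module.Basis ι ℝ (V → ℝ)) (f g : V → ℝ) :
    B f g = ∑ i, ∑ j, b.repr f i * b.repr g j * B (b i) (b j) := by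
  nth_rw 1 [← b.sum_repr f, ← b.sum_repr g]
  simp only [map_sum, LinearMap.sum_apply, map_smul, LinearMap.smul_apply, smul_eq_mul,
    Finset.mul_sum]
  rw [Finset.sum_comm]
  exact Finset.sum_congr rfl fun i _ => Finset.sum_congr rfl fun j _ => by ring

omit [Fintype V] in
lemma sum_sq_repr {ι : Type*} [Fintype ι] [DecidableEq ι] {B : LinearMap.BilinForm ℝ (V → ℝ)}
    {b : Module.Basis ι ℝ (V → ℝ)} (hb : ∀ i j, B (b i) (b j) = if i = j then 1 else 0)
    (f : V → ℝ) : ∑ i, b.repr f i ^ 2 = B f f := by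
  rw [apply_sum_basis B b f f]
  refine Finset.sum_congr rfl fun i _ => ?_
  simp [hb, sq]

-- Cauchy–Schwarz in coordinates: the Hilbert–Schmidt norm dominates the operator norm.
omit [Fintype V] in
lemma bilin_sq_le {ι : Type*} [Fintype ι] [DecidableEq ι] {B : LinearMap.BilinForm ℝ (V → ℝ)}
    {b : Module.Basis ι ℝ (V → ℝ)} (hb : ∀ i j, B (b i) (b j) = if i = j then 1 else 0)
    (D : LinearMap.BilinForm ℝ (V → ℝ)) (f g : V → ℝ) :
    D f g ^ 2 ≤ (∑ i, ∑ j, D (b i) (b j) ^ 2) * (B f f * B g g) := by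
  rw [← sum_sq_repr hb f, ← sum_sq_repr hb g, apply_sum_basis D b f g, Finset.sum_mul_sum,
    mul_comm]
  simp only [← Fintype.sum_prod_type', ← mul_pow]
  exact Finset.sum_mul_sq_le_sq_mul_sq _ _ _

omit [Fintype V] in
lemma Edge.diff_sum_smul {ι : Type*} [Fintype ι] (e : G.Edge) (c : ι → ℝ) (b : ι → V → ℝ) :
    e.diff (∑ i, c i • b i) = ∑ i, c i * e.diff (b i) := by
  simp [Edge.diff, Finset.sum_apply, mul_sub, Finset.sum_sub_distrib]

/-- The sum is the squared dual norm of the difference along `e`. Applying the resistance bound to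
the vector representing this functional gives r² ≤ ρ r. -/
lemma sum_sq_diff_le {ι : Type*} [Fintype ι] [DecidableEq ι] {ρ : ℝ} (hρ : 0 ≤ ρ)
    (hgap : ∀ (f : V → ℝ) (u v : V), (f u - f v) ^ 2 ≤ ρ * G.form f f) {v : V}
    {b : Module.Basis ι ℝ (V → ℝ)}
    (hb : ∀ i j, G.pinned v (b i) (b j) = if i = j then 1 else 0) (e : G.Edge) :
    ∑ i, e.diff (b i) ^ 2 ≤ ρ := by
  set r := ∑ i, e.diff (b i) ^ 2 with hr
  set f := ∑ i, e.diff (b i) • b i with hf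
  have h1 : e.diff f = r := by
    rw [hf, Edge.diff_sum_smul]
    exact Finset.sum_congr rfl fun i _ => (sq _).symm
  have h2 : G.pinned v f f = r := by
    rw [← sum_sq_repr hb f]
    have : ∀ i, b.repr f i = e.diff (b i) := fun i => by
      rw [hf]; exact congrFun (b.repr_sum_self _) i
    simp only [this, hr]
  have h3 : G.form f f ≤ r := by
    rw [← h2, pinned_apply]
    exact le_add_of_nonneg_right (mul_self_nonneg _)
  have h4 : r ^ 2 ≤ ρ * r := by
    rw [← h1]
    exact (hgap f e.pos e.neg).trans (by rw [h1]; exact mul_le_mul_of_nonneg_left h3 hρ)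
  have h0 : 0 ≤ r := Finset.sum_nonneg fun i _ => sq_nonneg _
  rcases h0.eq_or_lt with h | h
  · rw [← h]; exact hρ
  · exact le_of_mul_le_mul_right (by rw [← sq]; exact h4) h

lemma integral_sum_sq_le [Nonempty G.Edge] {s : ℕ} (hs : 0 < s) {ρ : ℝ} (hρ : 0 ≤ ρ)
    (hgap : ∀ (f : V → ℝ) (u v : V), (f u - f v) ^ 2 ≤ ρ * G.form f f) {v : V}
    {b : Module.Basis (Fin (Fintype.card V)) ℝ (V → ℝ)}
    (hb : ∀ i j, G.pinned v (b i) (b j) = if i = j then 1 else 0) :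
    ∫ σ, ∑ i, ∑ j, ((sparsify σ).bilin - G.bilin) (b i) (b j) ^ 2 ∂G.sampleLaw s ≤
      G.totalWeight / s * (ρ * Fintype.card V) := by
  have hW := totalWeight_pos (G := G)
  have h1 : ∀ i j, ∫ σ, ((sparsify σ).bilin - G.bilin) (b i) (b j) ^ 2 ∂G.sampleLaw s ≤
      G.totalWeight / s * ∑ e : G.Edge, e.wt * (e.diff (b i) * e.diff (b j)) ^ 2 := by
    intro i j
    refine le_trans (le_of_eq ?_)
      (integral_sq_sample_sub_le hs fun e => e.diff (b i) * e.diff (b j))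
    refine integral_congr_ae (ae_of_all _ fun σ => ?_)
    simp only [LinearMap.sub_apply, bilin_apply, form_sparsify, form_eq_sum_edge G]
  have h2 : ∑ i, ∑ j, ∑ e : G.Edge, e.wt * (e.diff (b i) * e.diff (b j)) ^ 2 =
      ∑ e : G.Edge, e.wt * ((∑ i, e.diff (b i) ^ 2) * ∑ j, e.diff (b j) ^ 2) := by
    rw [Finset.sum_congr rfl fun y _ => Finset.sum_comm, Finset.sum_comm]
    refine Finset.sum_congr rfl fun e _ => ?_
    rw [Finset.sum_mul_sum, Finset.mul_sum]
    refine Finset.sum_congr rfl fun i _ => ?_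
    rw [Finset.mul_sum]
    exact Finset.sum_congr rfl fun j _ => by rw [mul_pow]
  -- A trace bound: each basis vector has energy at most its pinned norm, which is 1.
  have h3 : ∑ e : G.Edge, e.wt * ∑ i, e.diff (b i) ^ 2 ≤ Fintype.card V := by
    simp only [Finset.mul_sum]
    rw [Finset.sum_comm]
    calc _ ≤ ∑ i : Fin (Fintype.card V), (1 : ℝ) := by
          refine Finset.sum_le_sum fun i _ => ?_
          have := hb i i
          rw [if_pos rfl, pinned_apply, form_eq_sum_edge] at this
          simp only [sq]
          linarith [mul_self_nonneg (b i v)]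
      _ = _ := by simp
  rw [integral_finsetSum _ fun i _ => Integrable.of_finite]
  calc _ ≤ ∑ i, ∑ j, G.totalWeight / s *
        ∑ e : G.Edge, e.wt * (e.diff (b i) * e.diff (b j)) ^ 2 := by
        refine Finset.sum_le_sum fun i _ => ?_
        rw [integral_finsetSum _ fun i _ => Integrable.of_finite]
        exact Finset.sum_le_sum fun j _ => h1 i j
    _ = G.totalWeight / s *
        ∑ e : G.Edge, e.wt * ((∑ i, e.diff (b i) ^ 2) * ∑ j, e.diff (b j) ^ 2) := by
        rw [← h2]; simp only [Finset.mul_sum]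
    _ ≤ G.totalWeight / s * ∑ e : G.Edge, ρ * (e.wt * ∑ i, e.diff (b i) ^ 2) := by
        refine mul_le_mul_of_nonneg_left (Finset.sum_le_sum fun e _ => ?_) (by positivity)
        have h4 := sum_sq_diff_le hρ hgap hb e
        have h5 : 0 ≤ e.wt * ∑ i, e.diff (b i) ^ 2 :=
          mul_nonneg e.wt_pos.le (Finset.sum_nonneg fun i _ => sq_nonneg _)
        nlinarith
    _ ≤ _ := by
        rw [← Finset.mul_sum]
        gcongr

theorem sampleLaw_form_close [Nonempty G.Edge] [Nonempty V] {s : ℕ} (hs : 0 < s) {ρ : ℝ}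
    (hρ : 0 ≤ ρ)
    (hgap : ∀ (f : V → ℝ) (u v : V), (f u - f v) ^ 2 ≤ ρ * G.form f f) {ε : ℝ} (hε : 0 < ε)
    (hsε : 100 * (G.totalWeight * ρ * Fintype.card V) ≤ ε ^ 2 * s) :
    (99 / 100 : ℝ≥0∞) ≤ G.sampleLaw s {σ | ∀ f g,
      ((sparsify σ).form f g - G.form f g) ^ 2 ≤ ε ^ 2 * (G.form f f * G.form g g)} := by
  obtain ⟨v⟩ := ‹Nonempty V›
  obtain ⟨b, hb⟩ := exists_orthonormal_basis (G.pinned v)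
    (fun f g => by rw [pinned_apply, pinned_apply, form_comm, mul_comm]) (pinned_pos hgap v)
  set F : (Fin s → G.Edge) → ℝ := fun σ =>
    ∑ i, ∑ j, ((sparsify σ).bilin - G.bilin) (b i) (b j) ^ 2 with hF
  have hF0 : ∀ σ, 0 ≤ F σ := fun σ =>
    Finset.sum_nonneg fun i _ => Finset.sum_nonneg fun j _ => sq_nonneg _
  have hs' : (0 : ℝ) < s := by exact_mod_cast hs
  have hint : ∫ σ, F σ ∂G.sampleLaw s ≤ ε ^ 2 / 100 := by
    refine (integral_sum_sq_le hs hρ hgap hb).trans ?_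
    rw [div_mul_eq_mul_div, div_le_iff₀ hs']
    linarith
  have hmarkov : (G.sampleLaw s).real {σ | ε ^ 2 ≤ F σ} ≤ 1 / 100 := by
    have h := mul_meas_ge_le_integral_of_nonneg (ae_of_all (G.sampleLaw s) hF0)
      Integrable.of_finite (ε ^ 2)
    have h2 : 0 < ε ^ 2 := by positivity
    refine le_of_mul_le_mul_left ?_ h2
    linarith
  have hcompl : (99 / 100 : ℝ) ≤ (G.sampleLaw s).real {σ | ε ^ 2 ≤ F σ}ᶜ := by
    rw [probReal_compl_eq_one_sub (Set.toFinite _).measurableSet]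
    linarith
  have h99 : (99 / 100 : ℝ≥0∞) = ENNReal.ofReal (99 / 100) := by
    rw [ENNReal.ofReal_div_of_pos (by norm_num)]; simp
  rw [h99]
  refine (ENNReal.ofReal_le_of_le_toReal hcompl).trans (measure_mono fun σ hσ f g => ?_)
  have hlt : F σ < ε ^ 2 := not_le.1 hσ
  -- The forms ignore constants. Subtracting the values at `v` kills the pinning term, so the bound
  -- ends up in terms of `G.form` alone.
  have hshift : ∀ (G' : WGraph V) (f g : V → ℝ),
      G'.form (fun x => f x - f v) (fun x => g x - g v) = G'.form f g :=
    fun G' f g => G'.form_sub_const f g _ _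
  have h := bilin_sq_le hb ((sparsify σ).bilin - G.bilin) (fun x => f x - f v)
    (fun x => g x - g v)
  simp only [LinearMap.sub_apply, bilin_apply, pinned_apply, hshift, sub_self, mul_zero,
    add_zero] at h
  refine h.trans (mul_le_mul_of_nonneg_right hlt.le ?_)
  exact mul_nonneg (G.form_self_nonneg f) (G.form_self_nonneg g)

end Concentration

/-! ### Comparison principles for hitting times -/

section Comparison

variable {V : Type*} [Fintype V] [MeasurableSpace V] [DiscreteMeasurableSpace V] {G : WGraph V}

/-- Minimum principle: at a negative minimum of the difference, necessarily away from `v`, the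
Laplacian would be strictly negative because of the edge to `v`. -/
lemma le_hitR_of_subsolution {v : V} (hv : ∀ x, x ≠ v → 0 < G.weight x v)
    (hd : ∀ x, 0 < G.deg x) (hfin : ∀ u, G.hit u v ≠ ⊤) {f : V → ℝ} (hfv : f v ≤ 0)
    (hL : ∀ x, x ≠ v → G.lap f x ≤ G.deg x) (u : V) : f u ≤ G.hitR v u := by
  have : Nonempty V := ⟨u⟩
  obtain ⟨x, hx⟩ := Finite.exists_min (G.hitR v - f)
  suffices h : 0 ≤ (G.hitR v - f) x by
    have := h.trans (hx u)
    simpa using this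
  by_contra hneg
  push Not at hneg
  have hxv : x ≠ v := by
    rintro rfl
    simp at hneg
    linarith
  have h1 : 0 ≤ G.lap (G.hitR v - f) x := by
    rw [lap_sub, Pi.sub_apply, G.lap_hitR v hd hfin hxv]
    linarith [hL x hxv]
  have h2 : G.lap (G.hitR v - f) x < 0 := by
    have hw := hv x hxv
    refine Finset.sum_neg' (fun y _ => ?_) ⟨v, Finset.mem_univ v, ?_⟩
    · exact mul_nonpos_of_nonneg_of_nonpos (G.nonneg _ _) (sub_nonpos.2 (hx y))
    · refine mul_neg_of_pos_of_neg hw ?_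
      simp only [Pi.sub_apply, hitR_self] at hneg ⊢
      linarith
  linarith

lemma weight_pos_of_isComplete {W : Type*} {G : WGraph W} (hG : G.IsComplete) {u v : W}
    (h : u ≠ v) : 0 < G.weight u v := by
  have : G.toSimpleGraph.Adj u v := by rw [hG]; exact h
  exact this

lemma deg_pos_of_isComplete {W : Type*} [Fintype W] [Nontrivial W] {G : WGraph W}
    (hG : G.IsComplete) (u : W) : 0 < G.deg u := by
  obtain ⟨v, hv⟩ := exists_ne u
  exact Finset.sum_pos' (fun z _ => G.nonneg _ _)
    ⟨v, Finset.mem_univ _, weight_pos_of_isComplete hG hv.symm⟩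

lemma hit_ne_top_and_hitR_le {v : V} (hd : ∀ x, 0 < G.deg x) {f : V → ℝ} (hf : ∀ x, 0 ≤ f x)
    (hL : ∀ x, x ≠ v → G.deg x ≤ G.lap f x) (u : V) :
    G.hit u v ≠ ⊤ ∧ G.hitR v u ≤ f u := by
  have h := G.hit_le_ofReal v hd f hf hL u
  exact ⟨ne_top_of_le_ne_top ENNReal.ofReal_ne_top h, ENNReal.toReal_le_of_le_ofReal (hf u) h⟩

end Comparison

/-! ### Hitting times of order n in the two settings -/

section Bounds

variable {n : ℕ} {G : WGraph (Fin n)} {a b : ℝ}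

lemma hitR_bounds_of_isSingleCluster (ha : 0 < a) (hab : a ≤ b) (hn : 2 ≤ n)
    (hG : G.IsComplete) (hS : G.IsSingleCluster a b) (u v : Fin n) :
    G.hit u v ≠ ⊤ ∧ G.hitR v u ≤ b / a * n ∧ (u ≠ v → a / (2 * b) * n ≤ G.hitR v u) := by
  have hb : 0 < b := ha.trans_le hab
  have hn' : (2 : ℝ) ≤ n := by exact_mod_cast hn
  have : Nontrivial (Fin n) := Fin.nontrivial_iff_two_le.2 hn
  have hd : ∀ x, 0 < G.deg x := deg_pos_of_isComplete hG
  have hdu : ∀ x, G.deg x ≤ n * b := by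
    intro x
    calc G.deg x ≤ ∑ _y : Fin n, b := by
          refine Finset.sum_le_sum fun y _ => ?_
          by_cases h : x = y
          · rw [h, G.loopless]; exact hb.le
          · exact (hS x y h).2
      _ = n * b := by simp
  have hdl : ∀ x, (n - 1) * a ≤ G.deg x := by
    intro x
    calc (n - 1) * a = ∑ y : Fin n, (a - if y = x then a else 0) := by
          simp [Finset.sum_sub_distrib]; ring
      _ ≤ G.deg x := by
          refine Finset.sum_le_sum fun y _ => ?_
          by_cases h : y = x
          · rw [h, G.loopless, if_pos rfl, sub_self]
          · rw [if_neg h, sub_zero]; exact (hS x y (Ne.symm h)).1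
  let f : ℝ → Fin n → ℝ := fun K x => if x = v then 0 else K
  have hlap : ∀ K x, x ≠ v → G.lap (f K) x = G.weight x v * K := by
    intro K x hx
    unfold lap
    rw [Finset.sum_eq_single v (fun y _ hy => by simp [f, hx, hy]) (by simp)]
    simp [f, hx]
  have hfu : ∀ K, 0 ≤ K → f K u ≤ K := by
    intro K hK
    simp only [f]
    split_ifs
    · exact hK
    · exact le_rfl
  have hup : ∀ u, G.hit u v ≠ ⊤ ∧ G.hitR v u ≤ f (b / a * n) u := by
    refine hit_ne_top_and_hitR_le hd (fun x => ?_) fun x hx => ?_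
    · simp only [f]; split_ifs <;> positivity
    · rw [hlap _ x hx]
      calc G.deg x ≤ n * b := hdu x
        _ = a * (b / a * n) := by field_simp
        _ ≤ _ := mul_le_mul_of_nonneg_right (hS x v hx).1 (by positivity)
  refine ⟨(hup u).1, (hup u).2.trans (hfu _ (by positivity)), fun huv => ?_⟩
  have h := le_hitR_of_subsolution (f := f (a / (2 * b) * n))
    (fun x hx => weight_pos_of_isComplete hG hx) hd (fun u => (hup u).1) (by simp [f])
    (fun x hx => ?_) u
  · simpa [f, huv] using h
  · rw [hlap _ x hx]
    calc _ ≤ b * (a / (2 * b) * n) :=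
          mul_le_mul_of_nonneg_right (hS x v hx).2 (by positivity)
      _ = n / 2 * a := by field_simp
      _ ≤ (n - 1) * a := mul_le_mul_of_nonneg_right (by linarith) ha.le
      _ ≤ _ := hdl x

/-- Barriers taking three values: 0 at `v`, B on the rest of its cluster, A outside. All degrees are
of order k = √n, and a vertex outside sends weight of order k / n into the cluster of `v`, so A of
order n balances the equation there. -/
lemma hitR_bounds_of_isManyClusters (ha : 0 < a) (hab : a ≤ b) (hn : 2 ≤ n)
    (hG : G.IsComplete) (hM : G.IsManyClusters a b) (u v : Fin n) :
    G.hit u v ≠ ⊤ ∧ G.hitR v u ≤ (4 * b / a + 2 * b ^ 2 / a ^ 2) * n ∧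
      (u ≠ v → a / (2 * b) * (a / (2 * b + a)) * n ≤ G.hitR v u) := by
  obtain ⟨k, hnk, c, hcard, hin, hout⟩ := hM
  have hb : 0 < b := ha.trans_le hab
  have hn' : (2 : ℝ) ≤ n := by exact_mod_cast hn
  have hn0 : (0 : ℝ) < n := by linarith
  have hk2 : 2 ≤ k := by
    by_contra h
    have : k ≤ 1 := by omega
    have : k ^ 2 ≤ 1 := by nlinarith
    omega
  have hk' : (2 : ℝ) ≤ k := by exact_mod_cast hk2
  have hnk' : (n : ℝ) = k * k := by rw [hnk]; push_cast; ring
  have : Nontrivial (Fin n) := Fin.nontrivial_iff_two_le.2 hn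
  have hd : ∀ x, 0 < G.deg x := deg_pos_of_isComplete hG
  have hsum : ∀ (i : Fin k) (t : ℝ), ∑ y : Fin n, (if c y = i then t else 0) = k * t := by
    intro i t
    rw [← Finset.sum_filter, Finset.sum_const, hcard, nsmul_eq_mul]
  have hdu : ∀ x, G.deg x ≤ 2 * k * b := by
    intro x
    calc G.deg x ≤ ∑ y : Fin n, ((if c y = c x then b else 0) + b / n) := by
          refine Finset.sum_le_sum fun y _ => ?_
          have hbn : 0 ≤ b / n := by positivity
          by_cases hxy : x = y
          · rw [hxy, G.loopless, if_pos rfl]; positivity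
          · by_cases h : c x = c y
            · rw [if_pos h.symm]; linarith [(hin x y hxy h).2]
            · rw [if_neg (Ne.symm h)]; linarith [(hout x y h).2]
      _ = k * b + b := by
          rw [Finset.sum_add_distrib, hsum]
          simp only [Finset.sum_const, Finset.card_univ, Fintype.card_fin, nsmul_eq_mul]
          field_simp
      _ ≤ 2 * k * b := by nlinarith
  have hdl : ∀ x, k / 2 * a ≤ G.deg x := by
    intro x
    calc k / 2 * a ≤ k * a - a := by nlinarith
      _ = ∑ y : Fin n, ((if c y = c x then a else 0) - if y = x then a else 0) := by
          rw [Finset.sum_sub_distrib, hsum]; simp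
      _ ≤ G.deg x := by
          refine Finset.sum_le_sum fun y _ => ?_
          by_cases hxy : y = x
          · rw [hxy, G.loopless, if_pos rfl, if_pos rfl, sub_self]
          · rw [if_neg hxy, sub_zero]
            split_ifs with h
            · exact (hin x y (Ne.symm hxy) h.symm).1
            · exact G.nonneg _ _
  let f : ℝ → ℝ → Fin n → ℝ := fun A B x => if x = v then 0 else if c x = c v then B else A
  have hfv : ∀ A B, f A B v = 0 := fun A B => if_pos rfl
  have hfi : ∀ A B x, x ≠ v → c x = c v → f A B x = B := fun A B x h h' => by simp [f, h, h']
  have hfo : ∀ A B x, c x ≠ c v → f A B x = A := fun A B x h => by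
    have : x ≠ v := fun h' => h (by rw [h'])
    simp [f, h, this]
  have hf0 : ∀ A B x, 0 ≤ A → 0 ≤ B → 0 ≤ f A B x := by
    intro A B x hA hB
    simp only [f]; split_ifs <;> first | exact le_rfl | assumption
  have hup : ∀ u, G.hit u v ≠ ⊤ ∧ G.hitR v u ≤
      f (4 * b / a * n + 2 * b ^ 2 / a ^ 2 * n) (2 * b / a * n + 2 * b ^ 2 / a ^ 2 * n) u := by
    -- Outside the cluster, k · (a/n)(A - B) = 2kb forces A - B = 2bn/a. Inside, B solves aB - b(A -
    -- B) = 2nb, which is at least the degree bound 2kb.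
    set A := 4 * b / a * n + 2 * b ^ 2 / a ^ 2 * n with hA
    set B := 2 * b / a * n + 2 * b ^ 2 / a ^ 2 * n with hB
    have hA0 : 0 ≤ A := by positivity
    have hB0 : 0 ≤ B := by positivity
    have hAB : A - B = 2 * b / a * n := by rw [hA, hB]; ring
    have hAB0 : 0 ≤ A - B := by rw [hAB]; positivity
    refine hit_ne_top_and_hitR_le hd (fun x => hf0 A B x hA0 hB0) fun x hx => ?_
    refine (hdu x).trans ?_
    by_cases hc : c x = c v
    · calc 2 * k * b ≤ 2 * n * b := by
            have : (k : ℝ) ≤ n := by nlinarith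
            nlinarith
        _ = a * B - b * (A - B) := by rw [hAB, hB]; field_simp; ring
        _ = ∑ y : Fin n, ((if y = v then a * B else 0) - b / n * (A - B)) := by
            rw [Finset.sum_sub_distrib]; simp; field_simp
        _ ≤ _ := by
            refine Finset.sum_le_sum fun y _ => ?_
            have h0 : 0 ≤ b / n * (A - B) := by positivity
            rw [hfi A B x hx hc]
            by_cases hy : y = v
            · rw [if_pos hy, hy, hfv]
              have := mul_le_mul_of_nonneg_right (hin x v hx hc).1 hB0
              linarith
            · rw [if_neg hy]
              by_cases hcy : c y = c v
              · rw [hfi A B y hy hcy]; linarith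
              · rw [hfo A B y hcy]
                have := mul_le_mul_of_nonneg_right (hout x y (fun h => hcy (h ▸ hc))).2 hAB0
                linarith
    · calc 2 * k * b = k * (a / n * (A - B)) := by rw [hAB]; field_simp
        _ = ∑ y : Fin n, (if c y = c v then a / n * (A - B) else 0) := (hsum _ _).symm
        _ ≤ _ := by
            refine Finset.sum_le_sum fun y _ => ?_
            rw [hfo A B x hc]
            by_cases hcy : c y = c v
            · rw [if_pos hcy]
              have hw := (hout x y (fun h => hc (h.trans hcy))).1
              have hfy : f A B y ≤ B := by
                by_cases hy : y = v
                · rw [hy, hfv]; exact hB0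
                · rw [hfi A B y hy hcy]
              exact mul_le_mul hw (by linarith) hAB0 (G.nonneg _ _)
            · rw [if_neg hcy, hfo A B y hcy]; simp
  refine ⟨(hup u).1, (hup u).2.trans ?_, fun huv => ?_⟩
  · rw [add_mul]
    have h1 : 0 ≤ 2 * b / a * n := by positivity
    have h2 : 0 ≤ 2 * b ^ 2 / a ^ 2 * n := by positivity
    have h3 : 4 * b / a * n = 2 * (2 * b / a * n) := by ring
    simp only [f]
    split_ifs <;> linarith
  -- A makes the Laplacian outside at most k · (b/n)A = ka/2, a lower bound for the degree. B makes
  -- bB = a(A - B)/2, so that inside the cluster the Laplacian is at most 0, because (n - k)/n ≥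
  -- 1/2.
  · set A := a / (2 * b) * n with hA
    set B := a / (2 * b) * (a / (2 * b + a)) * n with hB
    have hA0 : 0 ≤ A := by positivity
    have hB0 : 0 ≤ B := by positivity
    have hBA : (2 * b + a) * B = a * A := by rw [hA, hB]; field_simp
    have hle : B ≤ A := by nlinarith
    have h := le_hitR_of_subsolution (f := f A B)
      (fun x hx => weight_pos_of_isComplete hG hx) hd (fun u => (hup u).1) (hfv A B).le
      (fun x hx => ?_) u
    · refine le_trans ?_ h
      by_cases hc : c u = c v
      · rw [hfi A B u huv hc]
      · rw [hfo A B u hc]; exact hle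
    by_cases hc : c x = c v
    · refine le_trans ?_ (G.deg_nonneg x)
      calc _ ≤ ∑ y : Fin n, ((if y = v then b * B else 0) -
            (a / n * (A - B) - if c y = c v then a / n * (A - B) else 0)) := by
            refine Finset.sum_le_sum fun y _ => ?_
            rw [hfi A B x hx hc]
            by_cases hy : y = v
            · rw [if_pos hy, hy, hfv, if_pos rfl]
              have := mul_le_mul_of_nonneg_right (hin x v hx hc).2 hB0
              linarith
            · rw [if_neg hy]
              by_cases hcy : c y = c v
              · rw [hfi A B y hy hcy, if_pos hcy]; linarith
              · rw [hfo A B y hcy, if_neg hcy]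
                have := mul_le_mul_of_nonneg_right (hout x y (fun h => hcy (h ▸ hc))).1
                  (sub_nonneg.2 hle)
                linarith
        _ = b * B - (n - k) / n * (a * (A - B)) := by
            rw [Finset.sum_sub_distrib, Finset.sum_sub_distrib, hsum]
            simp only [Finset.sum_ite_eq', Finset.mem_univ, if_true, Finset.sum_const,
              Finset.card_univ, Fintype.card_fin, nsmul_eq_mul]
            field_simp
        _ ≤ 0 := by
            have h1 : 1 / 2 ≤ ((n : ℝ) - k) / n := by
              rw [div_le_div_iff₀ two_pos hn0]; nlinarith
            have h2 : 0 ≤ a * (A - B) := mul_nonneg ha.le (sub_nonneg.2 hle)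
            have := mul_le_mul_of_nonneg_right h1 h2
            nlinarith
    · refine le_trans ?_ (hdl x)
      calc _ ≤ ∑ y : Fin n, (if c y = c v then b / n * A else 0) := by
            refine Finset.sum_le_sum fun y _ => ?_
            rw [hfo A B x hc]
            by_cases hcy : c y = c v
            · rw [if_pos hcy]
              refine mul_le_mul_of_nonneg (hout x y (fun h => hc (h.trans hcy))).2 ?_
                (G.nonneg _ _) hA0
              linarith [hf0 A B y hA0 hB0]
            · rw [if_neg hcy, hfo A B y hcy]; simp
        _ = k / 2 * a := by rw [hsum, hA]; field_simp

lemma exists_hitR_bounds (ha : 0 < a) (hab : a ≤ b) : ∃ c K : ℝ, 0 < c ∧ 0 < K ∧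
    ∀ (n : ℕ) (_ : 2 ≤ n) (G : WGraph (Fin n)) (_ : G.IsComplete)
      (_ : G.IsSingleCluster a b ∨ G.IsManyClusters a b) (u v : Fin n),
      G.hit u v ≠ ⊤ ∧ G.hitR v u ≤ K * n ∧ (u ≠ v → c * n ≤ G.hitR v u) := by
  have hb : 0 < b := ha.trans_le hab
  refine ⟨a / (2 * b) * (a / (2 * b + a)), 4 * b / a + 2 * b ^ 2 / a ^ 2, by positivity,
    by positivity, fun n hn G hG h u v => ?_⟩
  rcases h with h | h
  · obtain ⟨h1, h2, h3⟩ := hitR_bounds_of_isSingleCluster ha hab hn hG h u v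
    refine ⟨h1, h2.trans (mul_le_mul_of_nonneg_right ?_ n.cast_nonneg), fun huv =>
      le_trans (mul_le_mul_of_nonneg_right ?_ n.cast_nonneg) (h3 huv)⟩
    · have h4 : 0 < b / a := by positivity
      have h5 : 0 < 2 * b ^ 2 / a ^ 2 := by positivity
      have h6 : 4 * b / a = 4 * (b / a) := by ring
      linarith
    · refine mul_le_of_le_one_right (by positivity) ?_
      rw [div_le_one (by positivity)]
      linarith
  · exact hitR_bounds_of_isManyClusters ha hab hn hG h u v

end Bounds

end WGraph

end

/-! ### Choice of ε and conclusion -/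

open WGraph in
theorem mainTheorem5 (a b : ℝ) (ha : 0 < a) (hab : a ≤ b) :
    ∃ C : ℝ, 0 < C ∧
      ∀ (n : ℕ) (_ : 2 ≤ n) (G : WGraph (Fin n)) (_ : G.IsComplete)
        (_ : G.IsSingleCluster a b ∨ G.IsManyClusters a b),
        (∀ u v, G.hit u v ≠ ⊤) ∧
        ∀ s : ℕ, C * (⨆ (u : Fin n) (v : Fin n), G.hit u v).toReal * n ≤ s →
          (99 / 100 : ℝ≥0∞) ≤ G.sampleLaw s {σ |
            (WGraph.sparsify σ).toSimpleGraph.edgeSet.ncard ≤ s ∧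
            (WGraph.sparsify σ).toSimpleGraph.Connected ∧
            ∀ u v, (WGraph.sparsify σ).hit u v ≠ ⊤ ∧
              |(G.hit u v).toReal - ((WGraph.sparsify σ).hit u v).toReal| ≤
                √(n * (G.hit u v).toReal)} := by
  -- The bound 1/2 serves the perturbation argument; √c / (8K) makes the error 8εH ≤ 8εKn at most √c
  -- · n ≤ √(n h).
  obtain ⟨c, K, hc, hK, hbd⟩ := exists_hitR_bounds ha hab
  set ε := min (1 / 2) (√c / (8 * K)) with hεdef
  have hε : 0 < ε := lt_min (by norm_num) (by positivity)
  have hε2 : ε ≤ 1 / 2 := min_le_left _ _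
  have hεc : 8 * ε * K ≤ √c := by
    have : ε ≤ √c / (8 * K) := min_le_right _ _
    rw [le_div_iff₀ (by positivity)] at this
    linarith
  refine ⟨100 / ε ^ 2, by positivity, fun n hn G hG hset => ?_⟩
  have hfin : ∀ u v, G.hit u v ≠ ⊤ := fun u v => (hbd n hn G hG hset u v).1
  refine ⟨hfin, fun s hs => ?_⟩
  have hn0 : (0 : ℝ) < n := by exact_mod_cast (by omega : 0 < n)
  have : Nontrivial (Fin n) := Fin.nontrivial_iff_two_le.2 hn
  have hd : ∀ x, 0 < G.deg x := deg_pos_of_isComplete hG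
  set H := (⨆ (u : Fin n) (v : Fin n), G.hit u v).toReal with hHdef
  have hle : ⨆ (u : Fin n) (v : Fin n), G.hit u v ≤ ENNReal.ofReal (K * n) :=
    iSup₂_le fun u v => (ENNReal.le_ofReal_iff_toReal_le (hfin u v) (by positivity)).2
      (hbd n hn G hG hset u v).2.1
  have hHK : H ≤ K * n := ENNReal.toReal_le_of_le_ofReal (by positivity) hle
  have hH : ∀ u v, G.hitR v u ≤ H := fun u v =>
    ENNReal.toReal_mono (ne_top_of_le_ne_top ENNReal.ofReal_ne_top hle)
      (le_iSup₂ (f := fun u v => G.hit u v) u v)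
  obtain ⟨x, y, hxy⟩ := exists_pair_ne (Fin n)
  have hH0 : 0 < H :=
    (mul_pos hc hn0).trans_le (((hbd n hn G hG hset x y).2.2 hxy).trans (hH x y))
  have hs0 : 0 < s := by
    have : (0 : ℝ) < s := lt_of_lt_of_le (by positivity) hs
    exact_mod_cast this
  have : Nonempty G.Edge := ⟨⟨s(x, y), weight_pos_of_isComplete hG hxy⟩⟩
  have hvol : 0 < G.vol := Finset.sum_pos (fun x _ => hd x) ⟨x, Finset.mem_univ _⟩
  have hconc := sampleLaw_form_close hs0 (div_nonneg (by positivity) hvol.le)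
    (gap_of_hit_le hd hfin hH) hε (by
      -- The volume cancels, so the sample size needed is governed by nH alone.
      have h1 : G.totalWeight * (2 * H / G.vol) = H := by
        have := G.vol_eq
        rw [this] at hvol ⊢
        have : G.totalWeight ≠ 0 := by linarith
        field_simp
      rw [h1, Fintype.card_fin]
      rw [div_mul_eq_mul_div, div_mul_eq_mul_div, div_le_iff₀ (by positivity)] at hs
      linarith)
  refine hconc.trans (MeasureTheory.measure_mono fun σ hσ => ?_)
  have hgap := gap_of_form_close hε.le hε2 hσ hd hfin hH
  have hd' : ∀ z, 0 < (sparsify σ).deg z := fun z => by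
    have h1 := (abs_le.1 (abs_deg_sub_le hε.le hσ z)).1
    nlinarith [hd z]
  have hρ : 0 ≤ 2 * (2 * H / G.vol) := by positivity
  have hfin' := (sparsify σ).hit_ne_top_of_gap hd' hρ hgap
  refine ⟨ncard_edgeSet_sparsify_le σ, connected_of_gap _ hgap, fun u v => ⟨hfin' u v, ?_⟩⟩
  by_cases huv : u = v
  · subst huv
    simp [hit_self]
  · refine (abs_hitR_sub_le hε.le hε2 hσ hd hfin hH hd' hfin' u v).trans ?_
    refine Real.le_sqrt_of_sq_le ?_
    have hlow := (hbd n hn G hG hset u v).2.2 huv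
    calc (8 * ε * H) ^ 2 ≤ (8 * ε * (K * n)) ^ 2 := by gcongr
      _ = (8 * ε * K) ^ 2 * n ^ 2 := by ring
      _ ≤ (√c) ^ 2 * n ^ 2 := by gcongr
      _ = n * (c * n) := by rw [Real.sq_sqrt hc.le]; ring
      _ ≤ n * (G.hit u v).toReal := mul_le_mul_of_nonneg_left hlow hn0.le
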